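/- A map between Banach lattices is called a lattice embedding if it is a linear isometry (into) that preserves finite suprema and infima, and a lattice automorphism of $X$ is a surjective lattice embedding $X\to X$. For $1\le p,q<\infty$ let $L_p(L_q)=L_p([0,1];L_q([0,1]))$ with Lebesgue measure, the pointwise almost everywhere order and the norm $\|f\|=\big(\int_0^1\|f(x)\|_{L_q}^p\,dx\big)^{1/p}$. A $BL_pL_q$ lattice is a Banach lattice that is isometrically lattice isomorphic to a band of $L_p(\Omega;L_q(\Omega'))$ for some measure spaces $\Omega,\Omega'$. Let $B\mathcal K_{p,q}$ be the class of finite-dimensional $BL_pL_q$ lattices. Theorem. Let $1\le p\ne q<\infty$. Then $L_p(L_q)$ is approximately ultrahomogeneous over $B\mathcal K_{p,q}$: for every $E\in B\mathcal K_{p,q}$, all $e_1,\dots,e_n$ generating $E$ as a Banach lattice, all lattice embeddings $f_1,f_2:E\to L_p(L_q)$, and every $\varepsilon>0$, there is a lattice automorphism $\phi$ of $L_p(L_q)$ such that $\|\phi(f_1(e_j))-f_2(e_j)\|<\varepsilon$ for every $1\le j\le n$. -/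

import Mathlib

open MeasureTheory Set
open scoped ENNReal

universe u v w

/-- A map between lattices that preserves binary suprema and infima. -/
def PreservesLattice {E : Type u} {F : Type v} [Lattice E] [Lattice F] (f : E → F) : Prop :=
  (∀ x y, f (x ⊔ y) = f x ⊔ f y) ∧ (∀ x y, f (x ⊓ y) = f x ⊓ f y)

/-- A band in a vector lattice: a solid linear subspace that contains the supremum of each of its
nonempty subsets whose supremum exists in the whole space. -/
structure IsBand {X : Type u} [AddCommGroup X] [Module ℝ X] [Lattice X]
    (B : Submodule ℝ X) : Prop where
  solid : LatticeOrderedAddCommGroup.IsSolid (B : Set X)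
  sup_mem : ∀ S : Set X, S ⊆ (B : Set X) → S.Nonempty → ∀ x : X, IsLUB S x → x ∈ B

/-- The elements `e i` generate `E` as a Banach lattice: the only closed vector sublattice that
contains all of them is `E` itself. -/
def GeneratesLattice {E : Type u} [NormedAddCommGroup E] [NormedSpace ℝ E] [Lattice E]
    {ι : Type v} (e : ι → E) : Prop :=
  ∀ S : Submodule ℝ E, IsClosed (S : Set E) →
    (∀ x ∈ S, ∀ y ∈ S, x ⊔ y ∈ S) → (∀ x ∈ S, ∀ y ∈ S, x ⊓ y ∈ S) →
    (∀ i, e i ∈ S) → S = ⊤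

/-- The Banach lattice `X` is approximately ultrahomogeneous over the class `G` of Banach lattices:
any two isometric lattice embeddings into `X` of a member of `G` agree, up to `ε` on a given finite
generating family and up to an isometric lattice automorphism of `X`. -/
def IsAUH (X : Type u) [NormedAddCommGroup X] [NormedSpace ℝ X] [Lattice X]
    (G : ∀ (E : Type v) [NormedAddCommGroup E] [NormedSpace ℝ E] [Lattice E], Prop) : Prop :=
  ∀ (E : Type v) [NormedAddCommGroup E] [NormedSpace ℝ E] [Lattice E]
    [IsOrderedAddMonoid E] [IsOrderedModule ℝ E] [HasSolidNorm E] [CompleteSpace E],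
    G E →
    ∀ (n : ℕ) (e : Fin n → E), GeneratesLattice e →
    ∀ f₁ f₂ : E →ₗᵢ[ℝ] X, PreservesLattice f₁ → PreservesLattice f₂ →
    ∀ ε : ℝ, 0 < ε →
      ∃ φ : X ≃ₗᵢ[ℝ] X, PreservesLattice φ ∧ ∀ j, ‖φ (f₁ (e j)) - f₂ (e j)‖ < ε

/-- `E` is a `BL_pL_q` lattice: it is lattice isometric to a band of `L_p(Ω; L_q(Ω'))` for some
measure spaces `Ω` and `Ω'`. -/
def IsBLpLq (p q : ℝ≥0∞) [Fact (1 ≤ p)] [Fact (1 ≤ q)]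
    (E : Type u) [NormedAddCommGroup E] [NormedSpace ℝ E] [Lattice E] : Prop :=
  ∃ (Ω : Type v) (_ : MeasurableSpace Ω) (μ : Measure Ω)
    (Ω' : Type w) (_ : MeasurableSpace Ω') (ν : Measure Ω')
    (T : E →ₗᵢ[ℝ] Lp (Lp ℝ q ν) p μ),
    PreservesLattice T ∧ IsBand T.toLinearMap.range

/-- The class of finite-dimensional `BL_pL_q` lattices. -/
def IsFinDimBLpLq (p q : ℝ≥0∞) [Fact (1 ≤ p)] [Fact (1 ≤ q)]
    (E : Type u) [NormedAddCommGroup E] [NormedSpace ℝ E] [Lattice E] : Prop :=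
  FiniteDimensional ℝ E ∧ IsBLpLq.{u, v, w} p q E

/-- Lebesgue measure on the unit interval. -/
noncomputable abbrev lebesgueUnit : Measure ℝ := volume.restrict (Icc 0 1)

/-- The Banach lattice `L_p(L_q) = L_p([0,1]; L_q([0,1]))`. -/
abbrev LpLq (p q : ℝ≥0∞) [Fact (1 ≤ p)] [Fact (1 ≤ q)] : Type :=
  Lp (Lp ℝ q lebesgueUnit) p lebesgueUnit

/-! A finite-dimensional Banach lattice is spanned by finitely many disjoint normalized atoms `e i`,
so it suffices to conjugate `f₁ (e i)` approximately to `f₂ (e i)` for all `i` at once. If `E` is a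
band of some `L_p(Ω; L_q(Ω'))`, the image of an atom cannot be cut by a measurable subset of `Ω`.
Hence the fibre norms of two atoms are either equal a.e. or disjointly supported, and `‖e i + e j‖`
is `2^(1/q)` or `2^(1/p)` accordingly (`norm_add_of_ae_zero_or_full`).

Because `p ≠ q`, these values are rigid. In any `L_p(L_q)`, disjoint unit vectors with sum of norm
`2^(1/q)` have equal fibre norms a.e., and those with sum of norm `2^(1/p)` have disjoint supports
in the base (`ae_norm_eq_of_norm_add`, `ae_eq_zero_of_norm_add`). These are the equality cases of
strict convexity or concavity, and of strict super- or subadditivity, of `t ↦ t^(p/q)`. So `f₁` and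
`f₂` have the same shape: over almost every base point only one class of atoms is alive, and its
values are disjoint positive vectors of one common norm.

Every such family is approximately the image of one fixed model family under an automorphism
(`exists_base_model`, `exists_simpleFunc_frames`). After a small perturbation the fibre values
jointly have full support and take finitely many values. Weighted compositions with measure
isomorphisms, in the fibres and then in the base, carry the model to them exactly. Comparing both
embeddings with the model finishes the proof. -/

/-! ### Isomorphisms between atomless finite measures on the line. -/

/-- `F` and `G` are mutually inverse isomorphisms of measure spaces, up to null sets. -/
structure AEIso {α : Type*} {β : Type*} [MeasurableSpace α] [MeasurableSpace β]
    (μ : Measure α) (ν : Measure β) (F : α → β) (G : β → α) : Prop where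
  fwd : MeasurePreserving F μ ν
  bwd : MeasurePreserving G ν μ
  left : ∀ᵐ x ∂μ, G (F x) = x
  right : ∀ᵐ y ∂ν, F (G y) = y

namespace AEIso

variable {α β γ : Type*} [MeasurableSpace α] [MeasurableSpace β] [MeasurableSpace γ]
  {μ : Measure α} {ν : Measure β} {ρ : Measure γ}

theorem symm {F : α → β} {G : β → α} (h : AEIso μ ν F G) : AEIso ν μ G F :=
  ⟨h.bwd, h.fwd, h.right, h.left⟩

theorem trans {F : α → β} {G : β → α} {F' : β → γ} {G' : γ → β}
    (h : AEIso μ ν F G) (h' : AEIso ν ρ F' G') : AEIso μ ρ (F' ∘ F) (G ∘ G') := by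
  refine ⟨h'.fwd.comp h.fwd, h.bwd.comp h'.bwd, ?_, ?_⟩
  · filter_upwards [h.left, h.fwd.quasiMeasurePreserving.ae h'.left] with x hx hx'
    simp [hx, hx']
  · filter_upwards [h'.right, h'.bwd.quasiMeasurePreserving.ae h.right] with x hx hx'
    simp [hx, hx']

end AEIso

section Cdf

variable (μ : Measure ℝ) [IsFiniteMeasure μ] [NullSingletonClass μ]

theorem continuous_measureReal_Iic : Continuous fun x => μ.real (Iic x) := by
  have h : (fun x => μ.real (Iic x)) = fun x => ∫ t, (Iic x).indicator (fun _ => (1 : ℝ)) t ∂μ := by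
    funext x
    rw [integral_indicator measurableSet_Iic]
    simp
  rw [h]
  refine continuous_iff_continuousAt.2 fun x₀ => ?_
  refine continuousAt_of_dominated (bound := fun _ => 1) ?_ ?_ (integrable_const _) ?_
  · exact Filter.Eventually.of_forall fun x =>
      (measurable_const.indicator measurableSet_Iic).aestronglyMeasurable
  · refine Filter.Eventually.of_forall fun x => Filter.Eventually.of_forall fun t => ?_
    by_cases ht : t ∈ Iic x <;> simp [ht, indicator]
  · have : ∀ᵐ t ∂μ, t ≠ x₀ := by
      rw [ae_iff]; simp
    filter_upwards [this] with t ht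
    rcases lt_or_gt_of_ne ht with h | h
    · refine (continuousAt_const (y := (1 : ℝ))).congr ?_
      filter_upwards [lt_mem_nhds h] with x hx
      simp [indicator, hx.le]
    · refine (continuousAt_const (y := (0 : ℝ))).congr ?_
      filter_upwards [gt_mem_nhds h] with x hx
      simp [indicator, hx]

/-- `F` is the distribution function, continuous since points are null, and `G` is its generalized
inverse. `F (G t) = t` holds on the whole open interval. `G (F x) = x` can fail only where `F` is
flat to the left of `x`, and the flat values are countably many. -/
theorem exists_aeIso_volume_Ioo :
    ∃ F G, AEIso μ (volume.restrict (Ioo 0 (μ.real univ))) F G := by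
  set M := μ.real univ with hM
  set F : ℝ → ℝ := fun x => μ.real (Iic x) with hF
  have hFc : Continuous F := continuous_measureReal_Iic μ
  have hFm : Monotone F := fun x y h => measureReal_mono (Iic_subset_Iic.2 h)
  have hF0 : ∀ x, 0 ≤ F x := fun x => measureReal_nonneg
  have hFM : ∀ x, F x ≤ M := fun x => measureReal_mono (subset_univ _)
  have htop : Filter.Tendsto F Filter.atTop (nhds M) :=
    (ENNReal.tendsto_toReal (measure_ne_top μ _)).comp (tendsto_measure_Iic_atTop μ)
  have hbot : Filter.Tendsto F Filter.atBot (nhds 0) := by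
    have h1 := tendsto_measure_iInter_atBot (μ := μ) (s := fun x : ℝ => Iic x)
      (fun _ => measurableSet_Iic.nullMeasurableSet) (fun _ _ h => Iic_subset_Iic.2 h)
      ⟨0, measure_ne_top μ _⟩
    have h2 : ⋂ x : ℝ, Iic x = ∅ := by
      ext x
      simp only [mem_iInter, mem_Iic, mem_empty_iff_false, iff_false, not_forall, not_le]
      exact ⟨x - 1, by linarith⟩
    rw [h2, measure_empty] at h1
    exact (ENNReal.tendsto_toReal ENNReal.zero_ne_top).comp h1
  -- The value `0` off `Ioo 0 M` is arbitrary: that set is null for the target measure.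
  set G : ℝ → ℝ := fun t => if t ∈ Ioo 0 M then sInf {x | t ≤ F x} else 0 with hG
  have hgal : ∀ t ∈ Ioo 0 M, ∀ x, G t ≤ x ↔ t ≤ F x := by
    intro t ht x
    have hne : {x | t ≤ F x}.Nonempty := by
      obtain ⟨x, hx⟩ := (htop.eventually (lt_mem_nhds ht.2)).exists
      exact ⟨x, hx.le⟩
    have hbd : BddBelow {x | t ≤ F x} := by
      obtain ⟨a, ha⟩ := (hbot.eventually (gt_mem_nhds ht.1)).exists
      refine ⟨a, fun x hx => ?_⟩
      by_contra hc
      exact absurd (hFm (not_le.1 hc).le) (not_le.2 (lt_of_lt_of_le ha hx))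
    have hcl : IsClosed {x | t ≤ F x} := isClosed_le continuous_const hFc
    have hmem := hcl.csInf_mem hne hbd
    simp only [hG, if_pos ht]
    exact ⟨fun h => le_trans hmem (hFm h), fun h => csInf_le hbd h⟩
  have hFG : ∀ t ∈ Ioo 0 M, F (G t) = t := by
    intro t ht
    refine le_antisymm ?_ ((hgal t ht _).1 le_rfl)
    by_contra hc
    have : ∀ᶠ x in nhds (G t), t < F x := hFc.continuousAt.eventually (lt_mem_nhds (not_le.1 hc))
    have := (this.filter_mono (nhdsWithin_le_nhds (s := Iio (G t)))).and self_mem_nhdsWithin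
    obtain ⟨x, hx, hx'⟩ := this.exists
    exact absurd ((hgal t ht x).2 hx.le) (not_le.2 hx')
  have hmap : μ.map F = volume.restrict (Ioo 0 M) := by
    refine Measure.ext_of_Iic _ _ fun a => ?_
    rw [Measure.map_apply hFc.measurable measurableSet_Iic,
      Measure.restrict_apply measurableSet_Iic]
    rcases lt_or_ge a 0 with ha | ha
    · have h1 : F ⁻¹' Iic a = ∅ := by
        ext x; simp [lt_of_lt_of_le ha (hF0 x)]
      have h2 : Iic a ∩ Ioo 0 M = ∅ := by
        ext x; simp only [mem_inter_iff, mem_Iic, mem_Ioo, mem_empty_iff_false, iff_false]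
        intro h; linarith [h.1, h.2.1]
      rw [h1, h2]; simp
    rcases lt_or_ge a M with haM | haM
    · have h2 : volume (Iic a ∩ Ioo 0 M) = ENNReal.ofReal a := by
        have : Iic a ∩ Ioo 0 M = Ioc 0 a := by
          ext x; simp only [mem_inter_iff, mem_Iic, mem_Ioo, mem_Ioc]
          constructor
          · intro h; exact ⟨h.2.1, h.1⟩
          · intro h; exact ⟨h.2, h.1, h.2.trans_lt haM⟩
        rw [this, Real.volume_Ioc, sub_zero]
      rw [h2]
      refine le_antisymm ?_ ?_
      -- `G` is not available at `a = 0`, so the bound is taken at some `b` slightly above `a` and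
      -- below `M`, where `{F ≤ a}` lies in `Iic (G b)`, of mass `b`.
      · refine le_of_forall_gt_imp_ge_of_dense fun c hc => ?_
        rcases eq_or_ne c ∞ with rfl | hct
        · exact le_top
        set b := min c.toReal ((a + M) / 2)
        have hac : a < c.toReal := by
          rwa [ENNReal.ofReal_lt_iff_lt_toReal ha hct] at hc
        have hb : a < b := lt_min hac (by linarith)
        have hbM : b < M := (min_le_right _ _).trans_lt (by linarith)
        have hbI : b ∈ Ioo 0 M := ⟨ha.trans_lt hb, hbM⟩
        have hsub : F ⁻¹' Iic a ⊆ Iic (G b) := by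
          intro x hx
          by_contra hc
          have := (hgal b hbI x).1 (not_le.1 hc).le
          exact absurd (this.trans hx) (not_le.2 hb)
        refine (measure_mono hsub).trans ?_
        have h3 : μ (Iic (G b)) = ENNReal.ofReal b := by
          conv_rhs => rw [← hFG b hbI, hF]
          simp
        rw [h3]
        exact ENNReal.ofReal_le_of_le_toReal (min_le_left _ _)
      · rcases ha.eq_or_lt with rfl | ha0
        · simp
        have haI : a ∈ Ioo 0 M := ⟨ha0, haM⟩
        have h3 : μ (Iic (G a)) = ENNReal.ofReal a := by
          conv_rhs => rw [← hFG a haI, hF]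
          simp
        rw [← h3]
        refine measure_mono fun x hx => ?_
        have := hFm hx
        rwa [hFG a haI] at this
    · have h1 : F ⁻¹' Iic a = univ := by
        ext x; simp [(hFM x).trans haM]
      have h2 : Iic a ∩ Ioo 0 M = Ioo 0 M := by
        ext x; simp only [mem_inter_iff, mem_Iic, mem_Ioo, and_iff_right_iff_imp]
        intro h; linarith [h.2]
      rw [h1, h2, Real.volume_Ioo, sub_zero, hM]; simp
  have hGm : Measurable G := by
    refine measurable_of_Iic fun a => ?_
    have : G ⁻¹' Iic a = (Ioo 0 M ∩ Iic (F a)) ∪ ((Ioo 0 M)ᶜ ∩ {_t | 0 ≤ a}) := by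
      ext t
      by_cases ht : t ∈ Ioo 0 M
      · simp only [mem_preimage, mem_Iic, hgal t ht, mem_union, mem_inter_iff, ht, true_and,
          mem_compl_iff, not_true, false_and, or_false]
      · simp only [mem_preimage, mem_Iic, mem_union, mem_inter_iff, ht, false_and, false_or,
          mem_compl_iff, not_false_iff, true_and, hG, mem_ofPred_eq, if_false]
    rw [this]
    exact (measurableSet_Ioo.inter measurableSet_Iic).union
      (measurableSet_Ioo.compl.inter (MeasurableSet.const _))
  have hmpF : MeasurePreserving F μ (volume.restrict (Ioo 0 M)) := ⟨hFc.measurable, hmap⟩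
  have hleft : ∀ᵐ x ∂μ, G (F x) = x := by
    have h1 : ∀ᵐ x ∂μ, F x ∈ Ioo 0 M :=
      hmpF.quasiMeasurePreserving.ae (ae_restrict_mem measurableSet_Ioo)
    -- A nontrivial flat interval of `F` contains a rational, so avoiding the values `F r` excludes
    -- all of them.
    have h2 : ∀ᵐ x ∂μ, ∀ r : ℚ, F x ≠ F r := by
      refine ae_all_iff.2 fun r => hmpF.quasiMeasurePreserving.ae (p := fun y => y ≠ F r) ?_
      rw [ae_iff]
      simp
    filter_upwards [h1, h2] with x hx hx'
    refine le_antisymm ((hgal _ hx x).2 le_rfl) ?_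
    by_contra hc
    obtain ⟨r, hr1, hr2⟩ := exists_rat_btwn (not_le.1 hc)
    have h3 : F x ≤ F r := by
      rw [← hFG _ hx]
      exact hFm hr1.le
    exact hx' r (le_antisymm h3 (hFm hr2.le))
  refine ⟨F, G, hmpF, ⟨hGm, ?_⟩, hleft, ?_⟩
  · rw [← hmap, Measure.map_map hGm hFc.measurable]
    have : G ∘ F =ᵐ[μ] id := hleft
    rw [Measure.map_congr this, Measure.map_id]
  · filter_upwards [ae_restrict_mem measurableSet_Ioo] with t ht using hFG t ht

end Cdf

theorem exists_aeIso (μ ν : Measure ℝ) [IsFiniteMeasure μ] [NullSingletonClass μ]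
    [IsFiniteMeasure ν] [NullSingletonClass ν] (h : μ univ = ν univ) : ∃ F G, AEIso μ ν F G := by
  obtain ⟨F, G, h1⟩ := exists_aeIso_volume_Ioo μ
  obtain ⟨F', G', h2⟩ := exists_aeIso_volume_Ioo ν
  have : μ.real univ = ν.real univ := by simp [Measure.real, h]
  rw [this] at h1
  exact ⟨_, _, h1.trans h2.symm⟩

section Glue

variable {K : Type*} [Finite K] [MeasurableSpace K] [MeasurableSingletonClass K]

theorem measurable_glue {κ : ℝ → K} (hκ : Measurable κ) {F : K → ℝ → ℝ}
    (hF : ∀ k, Measurable (F k)) : Measurable fun x => F (κ x) x := by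
  intro A hA
  have : (fun x => F (κ x) x) ⁻¹' A = ⋃ k, κ ⁻¹' {k} ∩ F k ⁻¹' A := by
    ext x; simp
  rw [this]
  exact MeasurableSet.iUnion fun k => (hκ (measurableSet_singleton k)).inter (hF k hA)

theorem measurePreserving_glue {μ ν : Measure ℝ} {κ κ' : ℝ → K} (hκ : Measurable κ)
    (hκ' : Measurable κ') {F : K → ℝ → ℝ}
    (hF : ∀ k, MeasurePreserving (F k) (μ.restrict (κ ⁻¹' {k})) (ν.restrict (κ' ⁻¹' {k}))) :
    MeasurePreserving (fun x => F (κ x) x) μ ν := by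
  cases nonempty_fintype K
  have key : ∀ (ρ : Measure ℝ) (θ : ℝ → K), Measurable θ → ∀ A, MeasurableSet A →
      ρ A = ∑ k, ρ (A ∩ θ ⁻¹' {k}) := by
    intro ρ θ hθ A hA
    rw [← tsum_fintype (fun k => ρ (A ∩ θ ⁻¹' {k})) (L := .unconditional _), ← measure_iUnion]
    · congr 1; ext x; simp
    · intro i j hij
      refine Set.disjoint_left.2 fun x hx hx' => hij ?_
      rw [← hx.2, ← hx'.2]
    · exact fun k => hA.inter (hθ (measurableSet_singleton k))
  have hm := measurable_glue hκ fun k => (hF k).measurable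
  refine ⟨hm, Measure.ext fun A hA => ?_⟩
  rw [Measure.map_apply hm hA, key μ κ hκ _ (hm hA), key ν κ' hκ' A hA]
  refine Finset.sum_congr rfl fun k _ => ?_
  have := (hF k).measure_preimage hA.nullMeasurableSet
  rw [Measure.restrict_apply hA, Measure.restrict_apply ((hF k).measurable hA)] at this
  rw [← this]
  congr 1
  ext x
  simp only [mem_inter_iff, mem_preimage, mem_singleton_iff, and_congr_left_iff]
  rintro rfl; rfl

theorem ae_glue {μ ν : Measure ℝ} {κ κ' : ℝ → K} (hκ : Measurable κ)
    (hκ' : Measurable κ') {F : K → ℝ → ℝ}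
    (hF : ∀ k, MeasurePreserving (F k) (μ.restrict (κ ⁻¹' {k})) (ν.restrict (κ' ⁻¹' {k}))) :
    ∀ᵐ x ∂μ, κ' (F (κ x) x) = κ x := by
  have : ∀ k, ∀ᵐ x ∂μ, κ x = k → κ' (F k x) = k := by
    intro k
    have := (hF k).quasiMeasurePreserving.ae (p := fun y => κ' y = k)
      (ae_restrict_mem (hκ' (measurableSet_singleton k)))
    exact (ae_restrict_iff' (hκ (measurableSet_singleton k))).1 this
  filter_upwards [ae_all_iff.2 this] with x hx
  exact hx _ rfl

/-- Two atomless finite measures on the line are isomorphic by a map that respects given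
finite partitions whose corresponding pieces have the same mass. -/
theorem exists_aeIso_partition (μ ν : Measure ℝ) [IsFiniteMeasure μ] [NullSingletonClass μ]
    [IsFiniteMeasure ν] [NullSingletonClass ν] {κ κ' : ℝ → K} (hκ : Measurable κ)
    (hκ' : Measurable κ') (h : ∀ k, μ (κ ⁻¹' {k}) = ν (κ' ⁻¹' {k})) :
    ∃ F G, AEIso μ ν F G ∧ ∀ᵐ x ∂μ, κ' (F x) = κ x := by
  have : ∀ k, ∃ F G, AEIso (μ.restrict (κ ⁻¹' {k})) (ν.restrict (κ' ⁻¹' {k})) F G := fun k =>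
    exists_aeIso _ _ (by simpa using h k)
  choose F G hFG using this
  have hF := fun k => (hFG k).fwd
  have hG := fun k => (hFG k).bwd
  have aux : ∀ {μ ν : Measure ℝ} {κ κ' : ℝ → K} {F G : K → ℝ → ℝ}, Measurable κ → Measurable κ' →
      (∀ k, AEIso (μ.restrict (κ ⁻¹' {k})) (ν.restrict (κ' ⁻¹' {k})) (F k) (G k)) →
      ∀ᵐ x ∂μ, G (κ' (F (κ x) x)) (F (κ x) x) = x := by
    intro μ ν κ κ' F G hκ hκ' hFG
    have : ∀ k, ∀ᵐ x ∂μ, κ x = k → G k (F k x) = x := fun k =>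
      (ae_restrict_iff' (hκ (measurableSet_singleton k))).1 (hFG k).left
    filter_upwards [ae_all_iff.2 this, ae_glue hκ hκ' fun k => (hFG k).fwd] with x hx hx'
    rw [hx']
    exact hx _ rfl
  exact ⟨_, _, ⟨measurePreserving_glue hκ hκ' hF, measurePreserving_glue hκ' hκ hG,
    aux hκ hκ' hFG, aux hκ' hκ fun k => (hFG k).symm⟩, ae_glue hκ hκ' hF⟩

end Glue

/-- The line splits into finitely many measurable pieces that all meet the unit interval in a
set of positive measure. -/
theorem exists_measurable_partition (K : Type*) [Finite K] [Nonempty K] [MeasurableSpace K] :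
    ∃ θ : ℝ → K, Measurable θ ∧ ∀ k, lebesgueUnit (θ ⁻¹' {k}) ≠ 0 := by
  obtain ⟨n, ⟨e⟩⟩ := Finite.exists_equiv_fin K
  have hn : 0 < n := Fin.pos (e (Classical.arbitrary K))
  -- The pieces are essentially the intervals `[k/n, (k+1)/n)`; the remainder mod `n` only makes the
  -- index defined on the whole line.
  refine ⟨fun x => e.symm ⟨⌊x * n⌋₊ % n, Nat.mod_lt _ hn⟩, ?_, fun k => ?_⟩
  · have : Measurable fun m : ℕ => e.symm ⟨m % n, Nat.mod_lt _ hn⟩ := measurable_from_top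
    exact this.comp (Nat.measurable_floor.comp (measurable_id.mul_const _))
  · have hn' : (0 : ℝ) < n := by exact_mod_cast hn
    have hk : ((e k : ℕ) : ℝ) + 1 ≤ n := by exact_mod_cast (e k).2
    have hsub : Ioo (((e k : ℕ) : ℝ) / n) (((e k : ℕ) + 1) / n) ⊆
        (fun x : ℝ => e.symm ⟨⌊x * n⌋₊ % n, Nat.mod_lt _ hn⟩) ⁻¹' {k} ∩ Icc 0 1 := by
      rintro x ⟨h1, h2⟩
      have h0 : 0 < x := lt_of_le_of_lt (by positivity) h1
      rw [div_lt_iff₀ hn'] at h1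
      rw [lt_div_iff₀ hn'] at h2
      refine ⟨?_, h0.le, ?_⟩
      · have : ⌊x * n⌋₊ = (e k : ℕ) := (Nat.floor_eq_iff (by positivity)).2 ⟨h1.le, h2⟩
        simp only [mem_preimage, mem_singleton_iff, this, Nat.mod_eq_of_lt (e k).2]
        simp
      · by_contra hc
        have : (n : ℝ) < x * n := by nlinarith [not_le.1 hc]
        linarith
    have hm := (measure_mono (μ := volume) hsub).trans (Measure.le_restrict_apply _ _)
    intro h0
    change lebesgueUnit _ = 0 at h0
    rw [h0, Real.volume_Ioo] at hm
    have : (((e k : ℕ) : ℝ) + 1) / n - (e k : ℕ) / n = 1 / n := by ring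
    rw [this] at hm
    simp [hn] at hm

/-! ### Lattice automorphisms from weighted compositions. -/

section WeightedComposition

variable {α M X : Type*} [MeasurableSpace α] {μ : Measure α} [NormedAddCommGroup X]
  [NormedSpace ℝ X]

/-- The weighted composition of `f` with the point map `F`, the weight `w` and the simple family
`ψ ∘ m` of isometries of the space of values. -/
def weightedComp (w : α → ℝ) (F : α → α) (m : SimpleFunc α M) (ψ : M → X ≃ₗᵢ[ℝ] X) (f : α → X) :
    α → X := fun s => w s • ψ (m s) (f (F s))

/-- Since `m` has finite range, the function is a finite sum of pieces with a fixed isometry, so no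
measurability of an operator-valued map is involved. -/
theorem stronglyMeasurable_simpleFunc_apply (m : SimpleFunc α M) (ψ : M → X ≃ₗᵢ[ℝ] X) {f : α → X}
    (hf : StronglyMeasurable f) : StronglyMeasurable fun s => ψ (m s) (f s) := by
  classical
  have : (fun s => ψ (m s) (f s)) =
      fun s => ∑ c ∈ m.range, (m ⁻¹' {c}).indicator (fun s => ψ c (f s)) s := by
    funext s
    rw [Finset.sum_eq_single (m s)]
    · simp
    · intro b _ hb
      simp [indicator, hb.symm]
    · intro h
      exact absurd (SimpleFunc.mem_range_self m s) h
  rw [this]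
  exact Finset.stronglyMeasurable_fun_sum _ fun c _ =>
    ((ψ c).continuous.comp_stronglyMeasurable hf).indicator (m.measurableSet_fiber c)

variable {w : α → ℝ} {F G : α → α} {m : SimpleFunc α M} {ψ : M → X ≃ₗᵢ[ℝ] X} {p : ℝ≥0∞}

theorem stronglyMeasurable_weightedComp (hw : Measurable w) (hF : Measurable F) {f : α → X}
    (hf : StronglyMeasurable f) : StronglyMeasurable (weightedComp w F m ψ f) :=
  hw.stronglyMeasurable.smul (stronglyMeasurable_simpleFunc_apply m ψ (hf.comp_measurable hF))

/-- The density `‖w‖^p` is the Jacobian that compensates the change of variable `F`. -/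
theorem eLpNorm_weightedComp (hp0 : p ≠ 0) (hp : p ≠ ∞) (hw : Measurable w)
    (hF : MeasurePreserving F (μ.withDensity fun s => ‖w s‖ₑ ^ p.toReal) μ) {f : α → X}
    (hf : StronglyMeasurable f) : eLpNorm (weightedComp w F m ψ f) p μ = eLpNorm f p μ := by
  rw [eLpNorm_eq_lintegral_rpow_enorm_toReal hp0 hp, eLpNorm_eq_lintegral_rpow_enorm_toReal hp0 hp]
  congr 1
  have hm : Measurable fun t => ‖f t‖ₑ ^ p.toReal := hf.enorm.pow_const _
  have h := lintegral_withDensity_eq_lintegral_mul μ (hw.enorm.pow_const p.toReal)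
    (hm.comp hF.measurable)
  simp only [Function.comp_apply] at h
  rw [← hF.lintegral_comp hm, h]
  refine lintegral_congr fun s => ?_
  simp only [weightedComp, enorm_smul, Pi.mul_apply]
  rw [ENNReal.mul_rpow_of_nonneg _ _ ENNReal.toReal_nonneg]
  rw [LinearIsometryEquiv.enorm_map]
  rfl

theorem absolutelyContinuous_withDensity_enorm (hw : Measurable w) (hw0 : ∀ᵐ s ∂μ, 0 < w s) :
    μ ≪ μ.withDensity fun s => ‖w s‖ₑ ^ p.toReal := by
  refine withDensity_absolutelyContinuous' (hw.enorm.pow_const _).aemeasurable ?_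
  filter_upwards [hw0] with s hs
  have h1 : ‖w s‖ₑ ≠ 0 := by simpa using hs.ne'
  exact (ENNReal.rpow_pos (pos_iff_ne_zero.2 h1) enorm_ne_top).ne'

variable [Fact (1 ≤ p)] [Lattice X] [HasSolidNorm X] [IsOrderedAddMonoid X]

/-- Positivity of `w` makes the operator preserve the lattice operations and makes `μ` absolutely
continuous with respect to the weighted measure. A.e. statements therefore pull back along `F`, and
the result does not depend on the representative `g`. -/
theorem exists_weightedComp_automorphism (hp : p ≠ ∞) (hw : Measurable w)
    (hw0 : ∀ᵐ s ∂μ, 0 < w s) (hsmul : ∀ c : ℝ, 0 < c → PreservesLattice fun x : X => c • x)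
    (hFG : AEIso (μ.withDensity fun s => ‖w s‖ₑ ^ p.toReal) μ F G)
    (hψ : ∀ c, PreservesLattice (ψ c)) :
    ∃ φ : Lp X p μ ≃ₗᵢ[ℝ] Lp X p μ, PreservesLattice φ ∧
      ∀ (f : Lp X p μ) (g : α → X), f =ᵐ[μ] g → φ f =ᵐ[μ] weightedComp w F m ψ g := by
  have hp0 : p ≠ 0 := (zero_lt_one.trans_le (Fact.out : 1 ≤ p)).ne'
  have hac := absolutelyContinuous_withDensity_enorm (p := p) hw hw0
  have hqmp : Measure.QuasiMeasurePreserving F μ μ :=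
    ⟨hFG.fwd.measurable, (hac.map hFG.fwd.measurable).trans hFG.fwd.quasiMeasurePreserving.2⟩
  have hmem : ∀ f : Lp X p μ, MemLp (weightedComp w F m ψ f) p μ := fun f =>
    ⟨(stronglyMeasurable_weightedComp hw hFG.fwd.measurable
      (Lp.stronglyMeasurable f)).aestronglyMeasurable,
      by rw [eLpNorm_weightedComp hp0 hp hw hFG.fwd (Lp.stronglyMeasurable f)]
         exact Lp.eLpNorm_lt_top f⟩
  have hcoe : ∀ f : Lp X p μ, (hmem f).toLp =ᵐ[μ] weightedComp w F m ψ f := fun f =>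
    (hmem f).coeFn_toLp
  let φ₀ : Lp X p μ →ₗᵢ[ℝ] Lp X p μ :=
    { toFun := fun f => (hmem f).toLp
      map_add' := by
        intro f g
        refine Lp.ext ?_
        filter_upwards [hcoe (f + g), hcoe f, hcoe g, Lp.coeFn_add (hmem f).toLp (hmem g).toLp,
          hqmp.ae (Lp.coeFn_add f g)] with s h1 h2 h3 h4 h5
        rw [h1, h4, Pi.add_apply, h2, h3]
        simp only [weightedComp, h5, Pi.add_apply, map_add, smul_add]
      map_smul' := by
        intro c f
        refine Lp.ext ?_
        filter_upwards [hcoe (c • f), hcoe f, Lp.coeFn_smul c (hmem f).toLp,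
          hqmp.ae (Lp.coeFn_smul c f)] with s h1 h2 h4 h5
        rw [h1, RingHom.id_apply, h4, Pi.smul_apply, h2]
        simp only [weightedComp, h5, Pi.smul_apply, map_smul, smul_comm c]
      norm_map' := by
        intro f
        simp only [LinearMap.coe_mk, AddHom.coe_mk]
        rw [Lp.norm_toLp, eLpNorm_weightedComp hp0 hp hw hFG.fwd (Lp.stronglyMeasurable f)]
        rfl }
  have hφ₀ : ∀ f, φ₀ f =ᵐ[μ] weightedComp w F m ψ f := hcoe
  have hsurj : Function.Surjective φ₀ := by
    intro g
    -- The equation `w s • ψ (m s) (f (F s)) = g s` solved at `s = G t`.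
    let f : α → X := fun t => (w (G t))⁻¹ • (ψ (m (G t))).symm (g (G t))
    have hf : StronglyMeasurable f := by
      have h1 : StronglyMeasurable fun s => (w s)⁻¹ • (ψ (m s)).symm (g s) :=
        hw.inv.stronglyMeasurable.smul
          (stronglyMeasurable_simpleFunc_apply m (fun c => (ψ c).symm) (Lp.stronglyMeasurable g))
      exact h1.comp_measurable hFG.bwd.measurable
    have hfg : weightedComp w F m ψ f =ᵐ[μ] g := by
      filter_upwards [hac.ae_le hFG.left, hw0] with s hs hs0
      simp only [weightedComp, f, hs, map_smul, LinearIsometryEquiv.apply_symm_apply]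
      rw [smul_smul, mul_inv_cancel₀ hs0.ne', one_smul]
    have hfm : MemLp f p μ := ⟨hf.aestronglyMeasurable, by
      rw [← eLpNorm_weightedComp (m := m) (ψ := ψ) hp0 hp hw hFG.fwd hf, eLpNorm_congr_ae hfg]
      exact Lp.eLpNorm_lt_top g⟩
    refine ⟨hfm.toLp, Lp.ext ?_⟩
    filter_upwards [hφ₀ hfm.toLp, hqmp.ae hfm.coeFn_toLp, hfg] with s h1 h2 h3
    rw [h1, ← h3]
    simp only [weightedComp, h2]
  refine ⟨LinearIsometryEquiv.ofSurjective φ₀ hsurj, ⟨fun f g => ?_, fun f g => ?_⟩,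
    fun f g hfg => ?_⟩
  · refine Lp.ext ?_
    simp only [LinearIsometryEquiv.coe_ofSurjective]
    filter_upwards [hφ₀ (f ⊔ g), hφ₀ f, hφ₀ g, Lp.coeFn_sup (φ₀ f) (φ₀ g),
      hqmp.ae (Lp.coeFn_sup f g), hw0] with s h1 h2 h3 h4 h5 h6
    rw [h1, h4, Pi.sup_apply, h2, h3]
    simp only [weightedComp, h5, Pi.sup_apply, (hψ _).1]
    exact (hsmul _ h6).1 _ _
  · refine Lp.ext ?_
    simp only [LinearIsometryEquiv.coe_ofSurjective]
    filter_upwards [hφ₀ (f ⊓ g), hφ₀ f, hφ₀ g, Lp.coeFn_inf (φ₀ f) (φ₀ g),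
      hqmp.ae (Lp.coeFn_inf f g), hw0] with s h1 h2 h3 h4 h5 h6
    rw [h1, h4, Pi.inf_apply, h2, h3]
    simp only [weightedComp, h5, Pi.inf_apply, (hψ _).2]
    exact (hsmul _ h6).2 _ _
  · filter_upwards [hφ₀ f, hqmp.ae hfg] with s h1 h2
    rw [LinearIsometryEquiv.coe_ofSurjective, h1]
    simp only [weightedComp, h2]

end WeightedComposition

theorem preservesLattice_real_smul {c : ℝ} (hc : 0 < c) :
    PreservesLattice fun x : ℝ => c • x :=
  ⟨fun x y => by simp [mul_max_of_nonneg _ _ hc.le],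
    fun x y => by simp [mul_min_of_nonneg _ _ hc.le]⟩

theorem preservesLattice_Lp_smul {α : Type*} [MeasurableSpace α] {μ : Measure α} {X : Type*}
    [NormedAddCommGroup X] [NormedSpace ℝ X] [Lattice X] [HasSolidNorm X] [IsOrderedAddMonoid X]
    (p : ℝ≥0∞) {c : ℝ} (hc : PreservesLattice fun x : X => c • x) :
    PreservesLattice fun x : Lp X p μ => c • x := by
  refine ⟨fun f g => Lp.ext ?_, fun f g => Lp.ext ?_⟩
  · filter_upwards [Lp.coeFn_smul c (f ⊔ g), Lp.coeFn_sup f g, Lp.coeFn_sup (c • f) (c • g),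
      Lp.coeFn_smul c f, Lp.coeFn_smul c g] with s h1 h2 h3 h4 h5
    rw [h1, h3, Pi.smul_apply, h2, Pi.sup_apply, Pi.sup_apply, h4, h5]
    exact hc.1 _ _
  · filter_upwards [Lp.coeFn_smul c (f ⊓ g), Lp.coeFn_inf f g, Lp.coeFn_inf (c • f) (c • g),
      Lp.coeFn_smul c f, Lp.coeFn_smul c g] with s h1 h2 h3 h4 h5
    rw [h1, h3, Pi.smul_apply, h2, Pi.inf_apply, Pi.inf_apply, h4, h5]
    exact hc.2 _ _

theorem lintegral_enorm_rpow_Lp {α X : Type*} [MeasurableSpace α] {μ : Measure α}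
    [NormedAddCommGroup X] {p : ℝ≥0∞} (hp0 : p ≠ 0) (hp : p ≠ ∞) (f : Lp X p μ) :
    ∫⁻ s, ‖f s‖ₑ ^ p.toReal ∂μ = ‖f‖ₑ ^ p.toReal := by
  rw [Lp.enorm_def, eLpNorm_eq_lintegral_rpow_enorm_toReal hp0 hp, ← ENNReal.rpow_mul,
    one_div_mul_cancel (ENNReal.toReal_pos hp0 hp).ne', ENNReal.rpow_one]

theorem isFiniteMeasure_of_partition {α K : Type*} [MeasurableSpace α] [Finite K] {ρ : Measure α}
    (κ : α → K) (h : ∀ k, ρ (κ ⁻¹' {k}) ≠ ∞) : IsFiniteMeasure ρ := by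
  cases nonempty_fintype K
  refine ⟨?_⟩
  have : (univ : Set α) = ⋃ k, κ ⁻¹' {k} := by ext x; simp
  rw [this]
  refine (measure_iUnion_fintype_le _ _).trans_lt ?_
  exact ENNReal.sum_lt_top.2 fun k _ => (h k).lt_top

/-- Points outside every `S j` get an arbitrary index `j₀`, so one fibre of `τ` also contains the
complement of the union. -/
theorem exists_measurable_index {α J : Type*} [MeasurableSpace α] [Countable J] [Nonempty J]
    [MeasurableSpace J] {S : J → Set α} (hS : ∀ j, MeasurableSet (S j))
    (hd : ∀ i j t, t ∈ S i → t ∈ S j → i = j) :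
    ∃ τ : α → J, Measurable τ ∧ ∀ j, ∀ t ∈ S j, τ t = j := by
  classical
  let j₀ : J := Classical.arbitrary J
  let τ : α → J := fun t => if h : ∃ j, t ∈ S j then h.choose else j₀
  have hτ : ∀ j, ∀ t ∈ S j, τ t = j := fun j t ht => by
    have h : ∃ j, t ∈ S j := ⟨j, ht⟩
    simp only [τ, dif_pos h]
    exact hd _ _ t h.choose_spec ht
  refine ⟨τ, measurable_to_countable' fun j => ?_, hτ⟩
  have : τ ⁻¹' {j} = S j ∪ ((⋃ i, S i)ᶜ ∩ {_t | j = j₀}) := by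
    ext t
    simp only [mem_preimage, mem_singleton_iff, mem_union, mem_inter_iff, mem_compl_iff,
      mem_iUnion, mem_ofPred_eq]
    by_cases h : ∃ i, t ∈ S i
    · obtain ⟨i, hi⟩ := h
      rw [hτ i t hi]
      constructor
      · rintro rfl; exact Or.inl hi
      · rintro (h | h)
        · exact hd _ _ t hi h
        · exact absurd ⟨i, hi⟩ h.1
    · have h' : t ∉ S j := fun h' => h ⟨j, h'⟩
      simp only [τ, dif_neg h, h', h, not_false_iff, true_and, false_or, eq_comm]
  rw [this]
  exact (hS j).union ((MeasurableSet.iUnion hS).compl.inter (MeasurableSet.const _))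

/-! ### Homogeneity of the fibre `L_q`. -/

section Fibre

variable {q : ℝ≥0∞} [Fact (1 ≤ q)] {J : Type*}

/-- A family of disjoint positive unit vectors of `L_q` whose supports cover the unit interval. -/
def IsDisjointCover (h : J → Lp ℝ q lebesgueUnit) : Prop :=
  (∀ j, ‖h j‖ = 1) ∧ ∀ᵐ t ∂lebesgueUnit, ∃ j, 0 < h j t ∧ ∀ i, i ≠ j → h i t = 0

/-- The model consists of normalized indicators of a partition `θ`. For a cover `h` with supports `τ
= j`, the weight is chosen so that `|w|^q` has the same mass on `τ = j` as Lebesgue measure on `θ =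
j`. An isomorphism matching the two partitions then carries `v j` to `h j`. The model does not
depend on `h`. -/
theorem exists_fibre_model (hq : q ≠ ∞) [Finite J] [Nonempty J] :
    ∃ v : J → Lp ℝ q lebesgueUnit, IsDisjointCover v ∧ ∀ h : J → Lp ℝ q lebesgueUnit,
      IsDisjointCover h →
      ∃ ψ : Lp ℝ q lebesgueUnit ≃ₗᵢ[ℝ] Lp ℝ q lebesgueUnit, PreservesLattice ψ ∧
        ∀ j, ψ (v j) = h j := by
  have hq0 : q ≠ 0 := (zero_lt_one.trans_le (Fact.out : 1 ≤ q)).ne'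
  have hQ : 0 < q.toReal := ENNReal.toReal_pos hq0 hq
  let _ : MeasurableSpace J := ⊤
  obtain ⟨θ, hθ, hθ0⟩ := exists_measurable_partition J
  have hθm : ∀ j, MeasurableSet (θ ⁻¹' {j}) := fun j => hθ (measurableSet_singleton j)
  let b : J → ℝ := fun j => lebesgueUnit.real (θ ⁻¹' {j})
  have hb : ∀ j, 0 < b j := fun j =>
    ENNReal.toReal_pos (hθ0 j) (measure_ne_top _ _)
  let a : J → ℝ := fun j => b j ^ (1 / q.toReal)
  have ha : ∀ j, 0 < a j := fun j => Real.rpow_pos_of_pos (hb j) _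
  let v : J → Lp ℝ q lebesgueUnit := fun j =>
    indicatorConstLp q (hθm j) (measure_ne_top _ _) (a j)⁻¹
  have hv : ∀ j, v j =ᵐ[lebesgueUnit] (θ ⁻¹' {j}).indicator fun _ => (a j)⁻¹ := fun j =>
    indicatorConstLp_coeFn
  refine ⟨v, ⟨fun j => ?_, ?_⟩, fun h hh => ?_⟩
  · rw [norm_indicatorConstLp hq0 hq, Real.norm_of_nonneg (inv_nonneg.2 (ha j).le)]
    exact inv_mul_cancel₀ (ha j).ne'
  · filter_upwards [ae_all_iff.2 hv] with t ht
    refine ⟨θ t, ?_, fun i hi => ?_⟩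
    · rw [ht]; simpa using ha _
    · rw [ht]; simp [indicator, hi.symm]
  · have hhm : ∀ j, Measurable (h j) := fun j => (Lp.stronglyMeasurable (h j)).measurable
    let S : J → Set ℝ := fun j => {t | 0 < h j t} ∩ ⋂ i, {t | i ≠ j → h i t = 0}
    have hS : ∀ j, MeasurableSet (S j) := fun j => by
      refine (measurableSet_lt measurable_const (hhm j)).inter (MeasurableSet.iInter fun i => ?_)
      by_cases hij : i = j
      · simp [hij]
      · simp only [ne_eq, hij, not_false_iff, true_imp_iff]
        exact measurableSet_eq_fun (hhm i) measurable_const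
    obtain ⟨τ, hτ, hτS⟩ := exists_measurable_index hS (by
      intro i j t hi hj
      by_contra hij
      have h1 : h i t = 0 := mem_iInter.1 hj.2 i hij
      have h2 : 0 < h i t := hi.1
      exact absurd h1 h2.ne')
    have hτm : ∀ j, MeasurableSet (τ ⁻¹' {j}) := fun j => hτ (measurableSet_singleton j)
    have hpos : ∀ᵐ t ∂lebesgueUnit, 0 < h (τ t) t ∧ ∀ i, i ≠ τ t → h i t = 0 := by
      filter_upwards [hh.2] with t ht
      obtain ⟨j, hj, hj'⟩ := ht
      rw [hτS j t ⟨hj, mem_iInter.2 hj'⟩]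
      exact ⟨hj, hj'⟩
    -- The factor `a` cancels the height `(a j)⁻¹` of `v j`, and `a j ^ q = b j` equates the masses
    -- because `‖h j‖ = 1`.
    let w : ℝ → ℝ := fun t => a (τ t) * h (τ t) t
    have hw : Measurable w := measurable_glue hτ (F := fun j t => a j * h j t) fun j =>
      (hhm j).const_mul _
    have hw0 : ∀ᵐ t ∂lebesgueUnit, 0 < w t := by
      filter_upwards [hpos] with t ht using mul_pos (ha _) ht.1
    set ρ := lebesgueUnit.withDensity fun s => ‖w s‖ₑ ^ q.toReal with hρ
    have hρτ : ∀ j, ρ (τ ⁻¹' {j}) = lebesgueUnit (θ ⁻¹' {j}) := by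
      intro j
      have h1 : ρ (τ ⁻¹' {j}) = ∫⁻ t, ‖a j‖ₑ ^ q.toReal * ‖h j t‖ₑ ^ q.toReal ∂lebesgueUnit := by
        rw [hρ, withDensity_apply _ (hτm j), ← lintegral_indicator (hτm j)]
        refine lintegral_congr_ae ?_
        filter_upwards [hpos] with t ht
        by_cases hj : τ t = j
        · subst hj
          rw [indicator_of_mem (by simp), ← ENNReal.mul_rpow_of_nonneg _ _ hQ.le, ← enorm_mul]
        · rw [indicator_of_notMem (by simpa using hj), ht.2 j (Ne.symm hj)]
          simp [hQ]
      have h2 : ‖h j‖ₑ = 1 := by rw [← ofReal_norm, hh.1 j, ENNReal.ofReal_one]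
      rw [h1, lintegral_const_mul _ ((hhm j).enorm.pow_const _),
        lintegral_enorm_rpow_Lp hq0 hq (h j), h2, ENNReal.one_rpow, mul_one,
        Real.enorm_of_nonneg (ha j).le, ENNReal.ofReal_rpow_of_nonneg (ha j).le hQ.le,
        ← Real.rpow_mul (hb j).le, one_div_mul_cancel hQ.ne', Real.rpow_one]
      exact ENNReal.ofReal_toReal (measure_ne_top _ _)
    have : IsFiniteMeasure ρ := isFiniteMeasure_of_partition τ fun j => by
      rw [hρτ]; exact measure_ne_top _ _
    obtain ⟨F, G, hFG, hF⟩ := exists_aeIso_partition ρ lebesgueUnit hτ hθ hρτ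
    obtain ⟨ψ, hψ, hψ'⟩ := exists_weightedComp_automorphism (p := q) (X := ℝ)
      (m := SimpleFunc.const ℝ ()) (ψ := fun _ => LinearIsometryEquiv.refl ℝ ℝ) hq hw hw0
      (fun c hc => preservesLattice_real_smul hc) hFG (fun _ => ⟨fun _ _ => rfl, fun _ _ => rfl⟩)
    refine ⟨ψ, hψ, fun j => Lp.ext ?_⟩
    have hF' : ∀ᵐ t ∂lebesgueUnit, θ (F t) = τ t :=
      (absolutelyContinuous_withDensity_enorm (p := q) hw hw0).ae_le hF
    filter_upwards [hψ' (v j) _ (hv j), hF', hpos] with t h1 h2 h3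
    rw [h1]
    simp only [weightedComp, LinearIsometryEquiv.coe_refl, id, smul_eq_mul, w]
    by_cases hj : τ t = j
    · subst hj
      rw [indicator_of_mem (by simpa using h2)]
      field_simp [(ha (τ t)).ne']
    · rw [indicator_of_notMem (by simpa [h2] using hj), h3.2 j (Ne.symm hj), mul_zero]

end Fibre

/-! ### Homogeneity of `L_p(L_q)` for simple frame-valued families. -/

section Base

variable {q : ℝ≥0∞} [Fact (1 ≤ q)] {ι K : Type*}

/-- The vectors `x i` with `κ i = k` are disjoint and positive, of norm `c`, and jointly have full
support; the other `x i` vanish. -/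
structure IsFrame (κ : ι → K) (k : K) (c : ℝ) (x : ι → Lp ℝ q lebesgueUnit) : Prop where
  pos : 0 < c
  eq_zero : ∀ i, κ i ≠ k → x i = 0
  cover : IsDisjointCover fun i : {i // κ i = k} => c⁻¹ • x i

/-- The tuples that are frames for some class `k`. -/
def frames (q : ℝ≥0∞) [Fact (1 ≤ q)] (κ : ι → K) : Set (ι → Lp ℝ q lebesgueUnit) :=
  {x | ∃ k c, IsFrame κ k c x}

theorem IsFrame.norm_eq {κ : ι → K} {k : K} {c : ℝ} {x : ι → Lp ℝ q lebesgueUnit}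
    (h : IsFrame κ k c x) {i : ι} (hi : κ i = k) : ‖x i‖ = c := by
  have := h.cover.1 ⟨i, hi⟩
  simp only [norm_smul, norm_inv, Real.norm_of_nonneg h.pos.le] at this
  field_simp [h.pos.ne'] at this
  exact this

theorem norm_eq_of_mem_frames {κ : ι → K} {x : ι → Lp ℝ q lebesgueUnit} (hx : x ∈ frames q κ)
    {i j : ι} (hij : κ i = κ j) : ‖x i‖ = ‖x j‖ := by
  obtain ⟨k, c, h⟩ := hx
  by_cases hi : κ i = k
  · rw [h.norm_eq hi, h.norm_eq (hij ▸ hi)]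
  · rw [h.eq_zero i hi, h.eq_zero j (hij ▸ hi)]

/-- The construction in the fibre is repeated over the base: class `k` of the model lives on `θ =
k`, with fibre model `v k` as constant value. Over a point where class `k` is alive, a fibre
automorphism takes `v k` to the normalized value of `X`, and the scalar weight restores the size. -/
theorem exists_base_model {p : ℝ≥0∞} [Fact (1 ≤ p)] (hp : p ≠ ∞) (hq : q ≠ ∞) [Finite ι]
    [Nonempty ι] {κ : ι → K} (hκ : Function.Surjective κ) :
    ∃ u : ι → LpLq p q, ∀ (X : SimpleFunc ℝ (ι → Lp ℝ q lebesgueUnit)) (x : ι → LpLq p q),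
      (∀ s, X s ∈ frames q κ) → (∀ i, x i =ᵐ[lebesgueUnit] fun s => X s i) → (∀ i, x i ≠ 0) →
      ∃ φ : LpLq p q ≃ₗᵢ[ℝ] LpLq p q, PreservesLattice φ ∧
        ∀ i, φ (u i) = ‖x i‖⁻¹ • x i := by
  have hp0 : p ≠ 0 := (zero_lt_one.trans_le (Fact.out : 1 ≤ p)).ne'
  have hP : 0 < p.toReal := ENNReal.toReal_pos hp0 hp
  have : Finite K := Finite.of_surjective κ hκ
  have : Nonempty K := ⟨κ (Classical.arbitrary ι)⟩
  let _ : MeasurableSpace K := ⊤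
  obtain ⟨θ, hθ, hθ0⟩ := exists_measurable_partition K
  have hθm : ∀ j, MeasurableSet (θ ⁻¹' {j}) := fun j => hθ (measurableSet_singleton j)
  have hne : ∀ k, Nonempty {i // κ i = k} := fun k => by
    obtain ⟨i, hi⟩ := hκ k
    exact ⟨⟨i, hi⟩⟩
  choose v _ hv using fun k => exists_fibre_model (J := {i // κ i = k}) hq
  let b : K → ℝ := fun j => lebesgueUnit.real (θ ⁻¹' {j})
  have hb : ∀ j, 0 < b j := fun j =>
    ENNReal.toReal_pos (hθ0 j) (measure_ne_top _ _)
  let a : K → ℝ := fun j => b j ^ (1 / p.toReal)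
  have ha : ∀ j, 0 < a j := fun j => Real.rpow_pos_of_pos (hb j) _
  let u : ι → LpLq p q := fun i =>
    indicatorConstLp p (hθm (κ i)) (measure_ne_top _ _) ((a (κ i))⁻¹ • v (κ i) ⟨i, rfl⟩)
  have hu : ∀ i, u i =ᵐ[lebesgueUnit]
      (θ ⁻¹' {κ i}).indicator fun _ => (a (κ i))⁻¹ • v (κ i) ⟨i, rfl⟩ := fun i =>
    indicatorConstLp_coeFn
  refine ⟨u, fun X x hX hx hx0 => ?_⟩
  -- The class, the norm and the automorphism are chosen as functions of the value `y`, not of the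
  -- base point, so that composing them with the simple function `X` gives simple functions.
  have hch : ∀ y : ι → Lp ℝ q lebesgueUnit, ∃ (k : K) (c : ℝ)
      (ψ : Lp ℝ q lebesgueUnit ≃ₗᵢ[ℝ] Lp ℝ q lebesgueUnit), PreservesLattice ψ ∧
      (y ∈ frames q κ → IsFrame κ k c y ∧ ∀ i : {i // κ i = k}, ψ (v k i) = c⁻¹ • y i) := by
    intro y
    by_cases hy : y ∈ frames q κ
    · obtain ⟨k, c, h⟩ := hy
      obtain ⟨ψ, h1, h2⟩ := hv k _ h.cover
      exact ⟨k, c, ψ, h1, fun _ => ⟨h, h2⟩⟩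
    · exact ⟨Classical.arbitrary K, 1, LinearIsometryEquiv.refl ℝ _,
        ⟨fun _ _ => rfl, fun _ _ => rfl⟩, fun h => absurd h hy⟩
  choose kf cf ψ hψ hfr using hch
  have hfr' := fun s => (hfr _ (hX s)).1
  have hψX := fun s => (hfr _ (hX s)).2
  have hxn : ∀ i j, κ i = κ j → ‖x i‖ = ‖x j‖ := by
    have : ∀ i j, κ i = κ j → ‖x i‖ ≤ ‖x j‖ := fun i j hij => by
      refine Lp.norm_le_norm_of_ae_le ?_
      filter_upwards [hx i, hx j] with s h1 h2
      rw [h1, h2, norm_eq_of_mem_frames (hX s) hij]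
    exact fun i j hij => le_antisymm (this i j hij) (this j i hij.symm)
  choose r hr using hκ
  let D : K → ℝ := fun k => ‖x (r k)‖
  have hD : ∀ k, 0 < D k := fun k => norm_pos_iff.2 (hx0 _)
  let τ : ℝ → K := fun s => kf (X s)
  have hτ : Measurable τ := (X.map kf).measurable
  have hτm : ∀ j, MeasurableSet (τ ⁻¹' {j}) := fun j => hτ (measurableSet_singleton j)
  -- `cf` undoes the fibre normalization, `D` normalizes the class in `L_p(L_q)`, and `a` cancels
  -- the height of the model.
  let w : ℝ → ℝ := fun s => a (τ s) / D (τ s) * cf (X s)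
  have hw : Measurable w := (X.map fun y => a (kf y) / D (kf y) * cf y).measurable
  have hw0 : ∀ s, 0 < w s := fun s => mul_pos (div_pos (ha _) (hD _)) (hfr' s).pos
  set ρ := lebesgueUnit.withDensity fun s => ‖w s‖ₑ ^ p.toReal with hρ
  have hρτ : ∀ k, ρ (τ ⁻¹' {k}) = lebesgueUnit (θ ⁻¹' {k}) := by
    intro k
    have h1 : ρ (τ ⁻¹' {k}) = ∫⁻ s, ‖((a k / D k) • x (r k)) s‖ₑ ^ p.toReal ∂lebesgueUnit := by
      rw [hρ, withDensity_apply _ (hτm k), ← lintegral_indicator (hτm k)]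
      refine lintegral_congr_ae ?_
      filter_upwards [hx (r k), Lp.coeFn_smul (a k / D k) (x (r k))] with s h1 h2
      rw [h2, Pi.smul_apply, h1]
      by_cases hk : τ s = k
      · rw [indicator_of_mem (by simpa using hk)]
        simp only [w, hk]
        rw [← ofReal_norm, ← ofReal_norm, norm_mul, norm_smul,
          (hfr' s).norm_eq (i := r k) ((hr k).trans hk.symm), Real.norm_of_nonneg (hfr' s).pos.le]
      · rw [indicator_of_notMem (by simpa using hk),
          (hfr' s).eq_zero (r k) (by rw [hr k]; exact Ne.symm hk)]
        simp [hP]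
    have h2 : ‖(a k / D k) • x (r k)‖ = a k := by
      rw [norm_smul, Real.norm_of_nonneg (div_pos (ha k) (hD k)).le]
      exact div_mul_cancel₀ _ (hD k).ne'
    rw [h1, lintegral_enorm_rpow_Lp hp0 hp, ← ofReal_norm, h2,
      ENNReal.ofReal_rpow_of_nonneg (ha k).le hP.le,
      ← Real.rpow_mul (hb k).le, one_div_mul_cancel hP.ne', Real.rpow_one]
    exact ENNReal.ofReal_toReal (measure_ne_top _ _)
  have : IsFiniteMeasure ρ := isFiniteMeasure_of_partition τ fun j => by
    rw [hρτ]; exact measure_ne_top _ _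
  obtain ⟨F, G, hFG, hF⟩ := exists_aeIso_partition ρ lebesgueUnit hτ hθ hρτ
  obtain ⟨φ, hφ, hφ'⟩ := exists_weightedComp_automorphism (p := p) (X := Lp ℝ q lebesgueUnit)
    (m := X) (ψ := ψ) hp hw (Filter.Eventually.of_forall hw0)
    (fun c hc => preservesLattice_Lp_smul q (preservesLattice_real_smul hc)) hFG hψ
  refine ⟨φ, hφ, fun i => Lp.ext ?_⟩
  have hF' : ∀ᵐ t ∂lebesgueUnit, θ (F t) = τ t :=
    (absolutelyContinuous_withDensity_enorm (p := p) hw (Filter.Eventually.of_forall hw0)).ae_le hF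
  filter_upwards [hφ' (u i) _ (hu i), hF', hx i, Lp.coeFn_smul (‖x i‖⁻¹) (x i)] with s h1 h2 h3 h4
  rw [h1, h4, Pi.smul_apply, h3]
  simp only [weightedComp]
  by_cases hk : τ s = κ i
  · rw [indicator_of_mem (by simpa [h2] using hk), map_smul, hxn i (r (κ i)) (hr _).symm]
    have h5 : ψ (X s) (v (κ i) ⟨i, rfl⟩) = (cf (X s))⁻¹ • X s i := by
      have hvk : ∀ k (h : κ i = k), v (κ i) ⟨i, rfl⟩ = v k ⟨i, h⟩ := by
        rintro _ rfl; rfl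
      rw [hvk _ hk.symm]
      exact hψX s ⟨i, hk.symm⟩
    rw [h5, smul_smul, smul_smul]
    congr 1
    simp only [w, hk]
    have := (hfr' s).pos.ne'
    have := (ha (κ i)).ne'
    have := (hD (κ i)).ne'
    simp only [D] at this ⊢
    field_simp
  · rw [indicator_of_notMem (by simpa [h2] using hk), (hfr' s).eq_zero i (Ne.symm hk)]
    simp

end Base

/-! ### Approximation of degenerate frames by simple frame-valued functions. -/

open scoped Topology

section Approximation

variable {q : ℝ≥0∞} [Fact (1 ≤ q)] {ι K : Type*}

/-- The vectors `x i` are disjoint and positive, those with `κ i = k` have the same norm, and the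
others vanish. -/
structure IsDegenerateFrame (κ : ι → K) (k : K) (c : ℝ) (x : ι → Lp ℝ q lebesgueUnit) : Prop where
  eq_zero : ∀ i, κ i ≠ k → x i = 0
  norm_eq : ∀ i, κ i = k → ‖x i‖ = c
  nonneg : ∀ i, ∀ᵐ t ∂lebesgueUnit, 0 ≤ x i t
  disjoint : ∀ i j, i ≠ j → ∀ᵐ t ∂lebesgueUnit, x i t = 0 ∨ x j t = 0

/-- Only full joint support is missing. It is obtained by adding `δ` times the indicator of the
common zero set `Z` to one vector `x i₀` of class `k` and rescaling that vector to norm `c`; then `δ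
→ 0`. -/
theorem IsDegenerateFrame.mem_closure_of_pos [Finite ι] {κ : ι → K}
    (hκ : Function.Surjective κ) {k : K} {c : ℝ} (hc : 0 < c)
    {x : ι → Lp ℝ q lebesgueUnit} (h : IsDegenerateFrame κ k c x) : x ∈ closure (frames q κ) := by
  classical
  obtain ⟨i₀, hi₀⟩ := hκ k
  have hxm : ∀ i, Measurable (x i) := fun i => (Lp.stronglyMeasurable (x i)).measurable
  let Z : Set ℝ := ⋂ i, {t | x i t = 0}
  have hZ : MeasurableSet Z := MeasurableSet.iInter fun i =>
    measurableSet_eq_fun (hxm i) measurable_const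
  let e : Lp ℝ q lebesgueUnit := indicatorConstLp q hZ (measure_ne_top _ _) 1
  let y : ℝ → Lp ℝ q lebesgueUnit := fun δ => x i₀ + δ • e
  have hy : Continuous y := by fun_prop
  have hy0 : y 0 = x i₀ := by simp [y]
  have hn0 : ‖y 0‖ = c := by rw [hy0, h.norm_eq i₀ hi₀]
  have hypos : ∀ᶠ δ in 𝓝[>] (0 : ℝ), 0 < ‖y δ‖ := by
    refine nhdsWithin_le_nhds (hy.norm.continuousAt.eventually (lt_mem_nhds ?_))
    change 0 < ‖y 0‖
    rwa [hn0]
  have hlim : Filter.Tendsto (fun δ => Function.update x i₀ ((c * ‖y δ‖⁻¹) • y δ)) (𝓝[>] 0)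
      (𝓝 x) := by
    have h1 : ContinuousAt (fun δ => (c * ‖y δ‖⁻¹) • y δ) 0 :=
      (continuousAt_const.mul (hy.norm.continuousAt.inv₀ (by rw [hn0]; exact hc.ne'))).smul
        hy.continuousAt
    have h2 : Filter.Tendsto (fun δ => (c * ‖y δ‖⁻¹) • y δ) (𝓝[>] 0) (𝓝 (x i₀)) := by
      have := h1.tendsto.mono_left (nhdsWithin_le_nhds (s := Ioi 0))
      rwa [hn0, mul_inv_cancel₀ hc.ne', one_smul, hy0] at this
    have h3 := (tendsto_const_nhds (x := x) (f := 𝓝[>] (0 : ℝ))).update i₀ h2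
    rwa [Function.update_eq_self] at h3
  refine mem_closure_of_tendsto hlim ?_
  filter_upwards [hypos, self_mem_nhdsWithin] with δ hδ hδ0
  have hδ0 : 0 < δ := hδ0
  have hcoef : 0 < ‖y δ‖⁻¹ := inv_pos.2 hδ
  refine ⟨k, c, hc, fun i hi => ?_, fun i => ?_, ?_⟩
  · rw [Function.update_of_ne (by rintro rfl; exact hi hi₀), h.eq_zero i hi]
  · change ‖c⁻¹ • Function.update x i₀ ((c * ‖y δ‖⁻¹) • y δ) i‖ = 1
    by_cases hi : i.1 = i₀
    · rw [hi, Function.update_self, smul_smul, inv_mul_cancel_left₀ hc.ne', norm_smul,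
        Real.norm_of_nonneg hcoef.le, inv_mul_cancel₀ hδ.ne']
    · rw [Function.update_of_ne hi, norm_smul, h.norm_eq i i.2, norm_inv,
        Real.norm_of_nonneg hc.le, inv_mul_cancel₀ hc.ne']
  · have hd : ∀ᵐ t ∂lebesgueUnit, ∀ i j, i ≠ j → x i t = 0 ∨ x j t = 0 := by
      refine ae_all_iff.2 fun i => ae_all_iff.2 fun j => ?_
      by_cases hij : i = j
      · simp [hij]
      · filter_upwards [h.disjoint i j hij] with t ht _ using ht
    have h1 : c⁻¹ • (c * ‖y δ‖⁻¹) • y δ = ‖y δ‖⁻¹ • y δ := by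
      rw [smul_smul, inv_mul_cancel_left₀ hc.ne']
    have hs : ∀ᵐ t ∂lebesgueUnit, ∀ i, i ≠ i₀ →
        (c⁻¹ • Function.update x i₀ ((c * ‖y δ‖⁻¹) • y δ) i) t = c⁻¹ * x i t := by
      refine ae_all_iff.2 fun i => ?_
      by_cases hi : i = i₀
      · simp [hi]
      · rw [Function.update_of_ne hi]
        filter_upwards [Lp.coeFn_smul c⁻¹ (x i)] with t ht _
        rw [ht]; rfl
    have hs0 : (c⁻¹ • Function.update x i₀ ((c * ‖y δ‖⁻¹) • y δ) i₀) =ᵐ[lebesgueUnit]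
        fun t => ‖y δ‖⁻¹ * (x i₀ t + δ * Z.indicator (fun _ => 1) t) := by
      rw [Function.update_self, h1]
      filter_upwards [Lp.coeFn_smul ‖y δ‖⁻¹ (y δ), Lp.coeFn_add (x i₀) (δ • e),
        Lp.coeFn_smul δ e, indicatorConstLp_coeFn (hs := hZ) (c := (1 : ℝ)) (p := q)
          (hμs := measure_ne_top lebesgueUnit Z)] with t h1 h2 h3 h4
      rw [h1, Pi.smul_apply, h2, Pi.add_apply, h3, Pi.smul_apply, h4]
      rfl
    have hz : ∀ᵐ t ∂lebesgueUnit, ∀ i, κ i ≠ k → x i t = 0 := by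
      refine ae_all_iff.2 fun i => ?_
      by_cases hi : κ i = k
      · simp [hi]
      · rw [h.eq_zero i hi]
        filter_upwards [Lp.coeFn_zero ℝ q lebesgueUnit] with t ht _ using ht
    filter_upwards [hd, ae_all_iff.2 h.nonneg, hs, hs0, hz] with t hd hn hs hs0 hz
    by_cases htZ : t ∈ Z
    · refine ⟨⟨i₀, hi₀⟩, ?_, fun i hi => ?_⟩
      · rw [hs0, indicator_of_mem htZ]
        have := hn i₀
        positivity
      · rw [hs i (fun hc => hi (Subtype.ext hc)), show x i t = 0 from mem_iInter.1 htZ i, mul_zero]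
    · obtain ⟨i, hi⟩ : ∃ i, x i t ≠ 0 := by
        by_contra hcon
        push Not at hcon
        exact htZ (mem_iInter.2 hcon)
      have hik : κ i = k := by
        by_contra hcon
        exact hi (hz i hcon)
      have hother : ∀ j, j ≠ i → x j t = 0 := fun j hj => (hd j i hj).resolve_right hi
      have hipos : 0 < x i t := lt_of_le_of_ne (hn i) (Ne.symm hi)
      have hval : ∀ j, (c⁻¹ • Function.update x i₀ ((c * ‖y δ‖⁻¹) • y δ) j) t =
          (if j = i₀ then ‖y δ‖⁻¹ else c⁻¹) * x j t := by
        intro j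
        by_cases hj : j = i₀
        · rw [hj, hs0, indicator_of_notMem htZ]
          simp
        · rw [hs j hj, if_neg hj]
      refine ⟨⟨i, hik⟩, ?_, fun j hj => ?_⟩
      · rw [hval]
        refine mul_pos ?_ hipos
        split_ifs
        · exact hcoef
        · exact inv_pos.2 hc
      · rw [hval, hother j (fun h => hj (Subtype.ext h)), mul_zero]

/-- When `c ≤ 0` the tuple is zero, and it is the limit of small multiples of a frame built on the
fibre model. -/
theorem IsDegenerateFrame.mem_closure (hq : q ≠ ∞) [Finite ι] {κ : ι → K}
    (hκ : Function.Surjective κ) {k : K} {c : ℝ}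
    {x : ι → Lp ℝ q lebesgueUnit} (h : IsDegenerateFrame κ k c x) : x ∈ closure (frames q κ) := by
  classical
  rcases lt_or_ge 0 c with hc | hc
  · exact h.mem_closure_of_pos hκ hc
  have hx : x = 0 := by
    funext i
    by_cases hi : κ i = k
    · exact norm_le_zero_iff.1 ((h.norm_eq i hi).trans_le hc)
    · exact h.eq_zero i hi
  have : Nonempty {i // κ i = k} := by
    obtain ⟨i, hi⟩ := hκ k
    exact ⟨⟨i, hi⟩⟩
  obtain ⟨v, hv, -⟩ := exists_fibre_model (q := q) (J := {i // κ i = k}) hq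
  let z : ι → Lp ℝ q lebesgueUnit := fun i => if h : κ i = k then v ⟨i, h⟩ else 0
  have hlim : Filter.Tendsto (fun δ : ℝ => δ • z) (𝓝[>] 0) (𝓝 x) := by
    have : Filter.Tendsto (fun δ : ℝ => δ • z) (𝓝 0) (𝓝 ((0 : ℝ) • z)) :=
      Filter.tendsto_id.smul_const z
    rw [zero_smul, ← hx] at this
    exact this.mono_left nhdsWithin_le_nhds
  refine mem_closure_of_tendsto hlim ?_
  filter_upwards [self_mem_nhdsWithin] with δ hδ
  have hδ : 0 < δ := hδ
  refine ⟨k, δ, hδ, fun i hi => ?_, ?_⟩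
  · simp [z, hi]
  · convert hv using 2 with i
    simp [z, i.2, smul_smul, hδ.ne']

/-- The approximants of `SimpleFunc.approxOn` take their values in `frames q κ` itself, while the
function approximated only needs values in the closure. -/
theorem exists_simpleFunc_frames {p : ℝ≥0∞} [Fact (1 ≤ p)] (hp : p ≠ ∞) (hq : q ≠ ∞) [Finite ι]
    [Nonempty ι] {κ : ι → K} (hκ : Function.Surjective κ) (x : ι → LpLq p q)
    (hx : ∀ᵐ s ∂lebesgueUnit, ∃ k c, IsDegenerateFrame κ k c fun i => x i s) {ε : ℝ} (hε : 0 < ε) :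
    ∃ (X : SimpleFunc ℝ (ι → Lp ℝ q lebesgueUnit)) (x' : ι → LpLq p q),
      (∀ s, X s ∈ frames q κ) ∧ (∀ i, x' i =ᵐ[lebesgueUnit] fun s => X s i) ∧
      ∀ i, ‖x' i - x i‖ < ε := by
  cases nonempty_fintype ι
  have : Fact (q ≠ ∞) := ⟨hq⟩
  let _ : MeasurableSpace (Lp ℝ q lebesgueUnit) := borel _
  have : BorelSpace (Lp ℝ q lebesgueUnit) := ⟨rfl⟩
  let f : ℝ → ι → Lp ℝ q lebesgueUnit := fun s i => x i s
  have hf : Measurable f := measurable_pi_iff.2 fun i => (Lp.stronglyMeasurable (x i)).measurable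
  have hcl : ∀ᵐ s ∂lebesgueUnit, f s ∈ closure (frames q κ) := by
    filter_upwards [hx] with s ⟨k, c, h⟩ using h.mem_closure hq hκ
  obtain ⟨y₀, hy₀⟩ : (frames q κ).Nonempty := by
    have hz : (0 : ι → Lp ℝ q lebesgueUnit) ∈ closure (frames q κ) := by
      refine IsDegenerateFrame.mem_closure (k := κ (Classical.arbitrary ι)) (c := 0) hq hκ
        ⟨fun _ _ => rfl, fun _ _ => norm_zero, fun i => ?_, fun i j _ => ?_⟩
      · filter_upwards [Lp.coeFn_zero ℝ q lebesgueUnit] with t ht using ht.ge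
      · filter_upwards [Lp.coeFn_zero ℝ q lebesgueUnit] with t ht using Or.inl ht
    exact closure_nonempty_iff.1 ⟨_, hz⟩
  have hfm : MemLp f p lebesgueUnit := memLp_pi_iff.2 fun i => Lp.memLp (x i)
  have hfin : eLpNorm (fun s => f s - y₀) p lebesgueUnit < ∞ := (hfm.sub (memLp_const y₀)).2
  have hlim := SimpleFunc.tendsto_approxOn_Lp_eLpNorm hf hy₀ hp hcl hfin
  obtain ⟨n, hn⟩ := (hlim.eventually (gt_mem_nhds (ENNReal.ofReal_pos.2 hε))).exists
  set X := SimpleFunc.approxOn f hf (frames q κ) y₀ hy₀ n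
  have hXm : MemLp X p lebesgueUnit := SimpleFunc.memLp_of_isFiniteMeasure _ _ _
  have hXi : ∀ i, MemLp (fun s => X s i) p lebesgueUnit := memLp_pi_iff.1 hXm
  refine ⟨X, fun i => (hXi i).toLp, fun s => SimpleFunc.approxOn_mem hf hy₀ n s,
    fun i => (hXi i).coeFn_toLp, fun i => ?_⟩
  rw [← ENNReal.ofReal_lt_ofReal_iff hε, ofReal_norm, Lp.enorm_def]
  refine lt_of_le_of_lt (eLpNorm_mono_ae ?_) hn
  filter_upwards [Lp.coeFn_sub (hXi i).toLp (x i), (hXi i).coeFn_toLp] with s h1 h2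
  rw [h1, Pi.sub_apply, h2]
  exact norm_le_pi_norm (X s - f s) i

end Approximation

/-! ### Approximate conjugacy through the common model. -/

section CanonicalForm

variable {q : ℝ≥0∞} [Fact (1 ≤ q)] {ι K : Type*}

/-- Any two families of unit vectors in `L_p(L_q)` whose values are degenerate frames are
approximately conjugate under a lattice automorphism. -/
theorem exists_automorphism_of_isDegenerateFrame {p : ℝ≥0∞} [Fact (1 ≤ p)] (hp : p ≠ ∞)
    (hq : q ≠ ∞) [Finite ι] [Nonempty ι] {κ : ι → K} (hκ : Function.Surjective κ)
    (x y : ι → LpLq p q) (hx1 : ∀ i, ‖x i‖ = 1) (hy1 : ∀ i, ‖y i‖ = 1)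
    (hx : ∀ᵐ s ∂lebesgueUnit, ∃ k c, IsDegenerateFrame κ k c fun i => x i s)
    (hy : ∀ᵐ s ∂lebesgueUnit, ∃ k c, IsDegenerateFrame κ k c fun i => y i s)
    {ε : ℝ} (hε : 0 < ε) :
    ∃ φ : LpLq p q ≃ₗᵢ[ℝ] LpLq p q, PreservesLattice φ ∧ ∀ i, ‖φ (x i) - y i‖ < ε := by
  obtain ⟨u, hu⟩ := exists_base_model (p := p) hp hq hκ
  have key : ∀ x : ι → LpLq p q, (∀ i, ‖x i‖ = 1) →
      (∀ᵐ s ∂lebesgueUnit, ∃ k c, IsDegenerateFrame κ k c fun i => x i s) →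
      ∃ φ : LpLq p q ≃ₗᵢ[ℝ] LpLq p q, PreservesLattice φ ∧ ∀ i, ‖φ (u i) - x i‖ < ε / 2 := by
    intro x hx1 hx
    -- Normalizing `x'` costs at most another `‖x' i - x i‖`, hence `ε / 4`; the bound `1 / 2` keeps
    -- `x' i` nonzero.
    obtain ⟨X, x', hX, hx', hn⟩ := exists_simpleFunc_frames hp hq hκ x hx
      (ε := min (ε / 4) (1 / 2)) (by positivity)
    have hd : ∀ i, |‖x' i‖ - 1| ≤ ‖x' i - x i‖ := fun i => by
      rw [← hx1 i]; exact abs_norm_sub_norm_le _ _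
    have hpos : ∀ i, 0 < ‖x' i‖ := fun i => by
      have h1 := (abs_le.1 (hd i)).1
      have h2 := (hn i).trans_le (min_le_right _ _)
      linarith
    obtain ⟨φ, hφ, hφu⟩ := hu X x' hX hx' fun i => norm_pos_iff.1 (hpos i)
    refine ⟨φ, hφ, fun i => ?_⟩
    have h3 : ‖‖x' i‖⁻¹ • x' i - x' i‖ = |‖x' i‖ - 1| := by
      have : ‖x' i‖⁻¹ • x' i - x' i = (‖x' i‖⁻¹ - 1) • x' i := by rw [sub_smul, one_smul]
      rw [this, norm_smul, Real.norm_eq_abs, abs_sub_comm]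
      nth_rewrite 2 [← abs_of_pos (hpos i)]
      rw [← abs_mul, sub_mul, one_mul, inv_mul_cancel₀ (hpos i).ne']
    have h2 := (hn i).trans_le (min_le_left _ _)
    calc ‖φ (u i) - x i‖ = ‖(‖x' i‖⁻¹ • x' i - x' i) + (x' i - x i)‖ := by rw [hφu]; congr 1; abel
      _ ≤ |‖x' i‖ - 1| + ‖x' i - x i‖ := by rw [← h3]; exact norm_add_le _ _
      _ < ε / 2 := by linarith [hd i]
  obtain ⟨φ, hφ, hφx⟩ := key x hx1 hx
  obtain ⟨χ, hχ, hχy⟩ := key y hy1 hy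
  have hsymm : PreservesLattice φ.symm :=
    ⟨fun f g => φ.injective (by simp [hφ.1]), fun f g => φ.injective (by simp [hφ.2])⟩
  refine ⟨φ.symm.trans χ, ⟨fun f g => ?_, fun f g => ?_⟩, fun i => ?_⟩
  · simp [hsymm.1, hχ.1]
  · simp [hsymm.2, hχ.2]
  · have h1 : ‖χ (φ.symm (x i)) - χ (u i)‖ < ε / 2 := by
      rw [← map_sub, LinearIsometryEquiv.norm_map, ← φ.norm_map, map_sub, φ.apply_symm_apply,
        norm_sub_rev]
      exact hφx i
    calc ‖(φ.symm.trans χ) (x i) - y i‖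
        = ‖(χ (φ.symm (x i)) - χ (u i)) + (χ (u i) - y i)‖ := by simp
      _ ≤ _ := norm_add_le _ _
      _ < ε := by linarith [hχy i]

end CanonicalForm

/-! ### Strict inequalities for powers. -/

section Rpow

/-- Used with `r = p / q`: the disjunction treats `p > q` (strict convexity) and `p < q` (strict
concavity) together. -/
theorem midpoint_rpow_dichotomy {r : ℝ} (hr0 : 0 < r) (hr : r ≠ 1) :
    (∀ a b : ℝ, 0 ≤ a → 0 ≤ b → a ≠ b → ((a + b) / 2) ^ r < (a ^ r + b ^ r) / 2) ∨
    (∀ a b : ℝ, 0 ≤ a → 0 ≤ b → a ≠ b → (a ^ r + b ^ r) / 2 < ((a + b) / 2) ^ r) := by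
  rcases lt_or_gt_of_ne hr with h | h
  · right
    intro a b ha hb hab
    have := (Real.strictConcaveOn_rpow hr0 h).2 ha hb hab
      (show (0 : ℝ) < 1 / 2 by norm_num) (show (0 : ℝ) < 1 / 2 by norm_num) (by norm_num)
    simp only [smul_eq_mul] at this
    rw [show (a + b) / 2 = 1 / 2 * a + 1 / 2 * b by ring]
    linarith
  · left
    intro a b ha hb hab
    have := (strictConvexOn_rpow h).2 ha hb hab
      (show (0 : ℝ) < 1 / 2 by norm_num) (show (0 : ℝ) < 1 / 2 by norm_num) (by norm_num)
    simp only [smul_eq_mul] at this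
    rw [show (a + b) / 2 = 1 / 2 * a + 1 / 2 * b by ring]
    linarith

/-- Write `a ^ r = a * a ^ (r - 1)` and use the strict monotonicity of `t ↦ t ^ (r - 1)`, increasing
or decreasing with the sign of `r - 1`. -/
theorem add_rpow_dichotomy {r : ℝ} (hr : r ≠ 1) :
    (∀ a b : ℝ, 0 < a → 0 < b → a ^ r + b ^ r < (a + b) ^ r) ∨
    (∀ a b : ℝ, 0 < a → 0 < b → (a + b) ^ r < a ^ r + b ^ r) := by
  have e : ∀ a : ℝ, 0 < a → a ^ r = a * a ^ (r - 1) := fun a ha => by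
    rw [Real.rpow_sub_one ha.ne']; field_simp
  rcases lt_or_gt_of_ne hr with h | h
  · right
    intro a b ha hb
    rw [e a ha, e b hb, e _ (add_pos ha hb), add_mul]
    exact add_lt_add
      (mul_lt_mul_of_pos_left (Real.rpow_lt_rpow_of_neg ha (by linarith) (by linarith)) ha)
      (mul_lt_mul_of_pos_left (Real.rpow_lt_rpow_of_neg hb (by linarith) (by linarith)) hb)
  · left
    intro a b ha hb
    rw [e a ha, e b hb, e _ (add_pos ha hb), add_mul]
    exact add_lt_add
      (mul_lt_mul_of_pos_left (Real.rpow_lt_rpow ha.le (by linarith) (by linarith)) ha)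
      (mul_lt_mul_of_pos_left (Real.rpow_lt_rpow hb.le (by linarith) (by linarith)) hb)

end Rpow

/-! ### Norms of sums determine the relative position of fibres. -/

section Rigidity

variable {α β : Type*} [MeasurableSpace α] [MeasurableSpace β] {μ : Measure α} {ν : Measure β}
  {p q : ℝ≥0∞}

theorem integrable_norm_rpow_Lp [Fact (1 ≤ p)] {X : Type*} [NormedAddCommGroup X] (hp : p ≠ ∞)
    (f : Lp X p μ) :
    Integrable (fun s => ‖f s‖ ^ p.toReal) μ :=
  (Lp.memLp f).integrable_norm_rpow (zero_lt_one.trans_le (Fact.out : 1 ≤ p)).ne' hp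

theorem integral_norm_rpow_Lp [Fact (1 ≤ p)] {X : Type*} [NormedAddCommGroup X] (hp : p ≠ ∞)
    (f : Lp X p μ) :
    ∫ s, ‖f s‖ ^ p.toReal ∂μ = ‖f‖ ^ p.toReal := by
  have hp0 : p ≠ 0 := (zero_lt_one.trans_le (Fact.out : 1 ≤ p)).ne'
  rw [integral_eq_lintegral_of_nonneg_ae
    (Filter.Eventually.of_forall fun s => Real.rpow_nonneg (norm_nonneg _) _)
    (integrable_norm_rpow_Lp hp f).1]
  have h := lintegral_enorm_rpow_Lp hp0 hp f
  simp only [← ofReal_norm, ENNReal.ofReal_rpow_of_nonneg (norm_nonneg _) ENNReal.toReal_nonneg]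
    at h
  rw [h, ENNReal.toReal_ofReal (Real.rpow_nonneg (norm_nonneg _) _)]

theorem ae_disjoint_of_inf_eq_zero {x y : Lp ℝ q ν} (h : x ⊓ y = 0) :
    ∀ᵐ t ∂ν, 0 ≤ x t ∧ 0 ≤ y t ∧ (x t = 0 ∨ y t = 0) := by
  filter_upwards [Lp.coeFn_inf x y, Lp.coeFn_zero ℝ q ν] with t h1 h2
  rw [h, h2] at h1
  simp only [Pi.zero_apply, Pi.inf_apply] at h1
  refine ⟨h1.le.trans inf_le_left, h1.le.trans inf_le_right, ?_⟩
  rcases le_total (x t) (y t) with h | h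
  · left; rw [h1, inf_eq_left.2 h]
  · right; rw [h1, inf_eq_right.2 h]

theorem norm_add_rpow_of_inf_eq_zero [Fact (1 ≤ q)] (hq : q ≠ ∞) {x y : Lp ℝ q ν}
    (h : x ⊓ y = 0) :
    ‖x + y‖ ^ q.toReal = ‖x‖ ^ q.toReal + ‖y‖ ^ q.toReal := by
  have hq0 : q ≠ 0 := (zero_lt_one.trans_le (Fact.out : 1 ≤ q)).ne'
  have hQ : q.toReal ≠ 0 := (ENNReal.toReal_pos hq0 hq).ne'
  rw [← integral_norm_rpow_Lp hq, ← integral_norm_rpow_Lp hq, ← integral_norm_rpow_Lp hq,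
    ← integral_add (integrable_norm_rpow_Lp hq x) (integrable_norm_rpow_Lp hq y)]
  refine integral_congr_ae ?_
  filter_upwards [ae_disjoint_of_inf_eq_zero h, Lp.coeFn_add x y] with t ht h2
  rw [h2, Pi.add_apply]
  rcases ht.2.2 with h0 | h0 <;> simp [h0, hQ]

theorem ae_inf_eq_zero [Fact (1 ≤ q)] {x y : Lp (Lp ℝ q ν) p μ} (h : x ⊓ y = 0) :
    ∀ᵐ s ∂μ, x s ⊓ y s = 0 := by
  filter_upwards [Lp.coeFn_inf x y, Lp.coeFn_zero (Lp ℝ q ν) p μ] with t h1 h2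
  rw [h, h2] at h1
  exact h1.symm

theorem ae_norm_add_rpow [Fact (1 ≤ q)] (hq : q ≠ ∞) {x y : Lp (Lp ℝ q ν) p μ} (h : x ⊓ y = 0) :
    ∀ᵐ s ∂μ, ‖(x + y) s‖ ^ p.toReal =
      (‖x s‖ ^ q.toReal + ‖y s‖ ^ q.toReal) ^ (p.toReal / q.toReal) := by
  have hq0 : q ≠ 0 := (zero_lt_one.trans_le (Fact.out : 1 ≤ q)).ne'
  have hQ : q.toReal ≠ 0 := (ENNReal.toReal_pos hq0 hq).ne'
  filter_upwards [ae_inf_eq_zero h, Lp.coeFn_add x y] with s h1 h2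
  rw [h2, Pi.add_apply, ← norm_add_rpow_of_inf_eq_zero hq h1, ← Real.rpow_mul (norm_nonneg _),
    mul_div_cancel₀ _ hQ]

/-- Two comparable functions with equal integrals agree a.e., so the inequality cannot be strict on
a set of positive measure. -/
theorem ae_of_integral_eq_of_dichotomy {f g : α → ℝ} (hf : Integrable f μ) (hg : Integrable g μ)
    (hfg : ∫ s, f s ∂μ = ∫ s, g s ∂μ) {P : α → Prop}
    (h : (∀ᵐ s ∂μ, f s ≤ g s ∧ (¬P s → f s < g s)) ∨ (∀ᵐ s ∂μ, g s ≤ f s ∧ (¬P s → g s < f s))) :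
    ∀ᵐ s ∂μ, P s := by
  have key : ∀ f g : α → ℝ, Integrable f μ → Integrable g μ → ∫ s, f s ∂μ = ∫ s, g s ∂μ →
      (∀ᵐ s ∂μ, f s ≤ g s ∧ (¬P s → f s < g s)) → ∀ᵐ s ∂μ, P s := by
    intro f g hf hg hfg h
    have h0 : ∫ s, (g - f) s ∂μ = 0 := by
      simp only [Pi.sub_apply]
      rw [integral_sub hg hf, hfg, sub_self]
    rw [integral_eq_zero_iff_of_nonneg_ae _ (hg.sub hf)] at h0
    · filter_upwards [h, h0] with s h1 h2
      by_contra hc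
      have := h1.2 hc
      simp only [Pi.sub_apply, Pi.zero_apply] at h2
      linarith
    · filter_upwards [h] with s h1
      simpa using h1.1
  rcases h with h | h
  · exact key f g hf hg hfg h
  · exact key g f hg hf hfg.symm h

theorem toReal_div_toReal_ne_one [Fact (1 ≤ q)] (hp : p ≠ ∞) (hq : q ≠ ∞) (hpq : p ≠ q) :
    p.toReal / q.toReal ≠ 1 := by
  have hq0 : q ≠ 0 := (zero_lt_one.trans_le (Fact.out : 1 ≤ q)).ne'
  intro h
  rw [div_eq_one_iff_eq (ENNReal.toReal_pos hq0 hq).ne'] at h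
  exact hpq ((ENNReal.toReal_eq_toReal_iff' hp hq).1 h)

/-- Put `a = ‖x s‖^q` and `b = ‖y s‖^q`. Both `((a + b)/2)^r` and `(a^r + b^r)/2` have integral `1`,
and they differ strictly wherever `a ≠ b`. -/
theorem ae_norm_eq_of_norm_add [Fact (1 ≤ p)] [Fact (1 ≤ q)] (hp : p ≠ ∞) (hq : q ≠ ∞)
    (hpq : p ≠ q) {x y : Lp (Lp ℝ q ν) p μ} (h : x ⊓ y = 0) (hx : ‖x‖ = 1) (hy : ‖y‖ = 1)
    (hxy : ‖x + y‖ = 2 ^ (1 / q.toReal)) : ∀ᵐ s ∂μ, ‖x s‖ = ‖y s‖ := by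
  have hp0 : p ≠ 0 := (zero_lt_one.trans_le (Fact.out : 1 ≤ p)).ne'
  have hq0 : q ≠ 0 := (zero_lt_one.trans_le (Fact.out : 1 ≤ q)).ne'
  have hP : 0 < p.toReal := ENNReal.toReal_pos hp0 hp
  have hQ : 0 < q.toReal := ENNReal.toReal_pos hq0 hq
  set r := p.toReal / q.toReal with hr
  have hr0 : 0 < r := div_pos hP hQ
  have e : ∀ a : ℝ, 0 ≤ a → (a ^ q.toReal) ^ r = a ^ p.toReal := fun a ha => by
    rw [← Real.rpow_mul ha, hr, mul_div_cancel₀ _ hQ.ne']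
  have hint : ∫ s, ‖(x + y) s‖ ^ p.toReal / 2 ^ r ∂μ =
      ∫ s, (‖x s‖ ^ p.toReal + ‖y s‖ ^ p.toReal) / 2 ∂μ := by
    rw [integral_div, integral_div,
      integral_add (integrable_norm_rpow_Lp hp x) (integrable_norm_rpow_Lp hp y),
      integral_norm_rpow_Lp hp, integral_norm_rpow_Lp hp, integral_norm_rpow_Lp hp, hx, hy, hxy,
      ← Real.rpow_mul (by norm_num), Real.one_rpow, one_div_mul_eq_div, ← hr,
      div_self (Real.rpow_pos_of_pos (by norm_num) _).ne']
    norm_num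
  refine ae_of_integral_eq_of_dichotomy ((integrable_norm_rpow_Lp hp (x + y)).div_const _)
    (((integrable_norm_rpow_Lp hp x).add (integrable_norm_rpow_Lp hp y)).div_const _) hint ?_
  have hval : ∀ᵐ s ∂μ, ‖(x + y) s‖ ^ p.toReal / 2 ^ r =
      ((‖x s‖ ^ q.toReal + ‖y s‖ ^ q.toReal) / 2) ^ r := by
    filter_upwards [ae_norm_add_rpow hq h] with s hs
    rw [hs, Real.div_rpow (by positivity) (by norm_num)]
  have hne : ∀ s, ¬‖x s‖ = ‖y s‖ → ‖x s‖ ^ q.toReal ≠ ‖y s‖ ^ q.toReal := fun s hs hc =>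
    hs ((Real.rpow_left_inj (norm_nonneg _) (norm_nonneg _) hQ.ne').1 hc)
  refine (midpoint_rpow_dichotomy hr0 (toReal_div_toReal_ne_one hp hq hpq)).imp
    (fun H => ?_) (fun H => ?_)
  all_goals
    filter_upwards [hval] with s hs
    simp only [Pi.add_apply]
    rw [hs, ← e _ (norm_nonneg (x s)), ← e _ (norm_nonneg (y s))]
    refine ⟨?_, fun hc => H _ _ (by positivity) (by positivity) (hne s hc)⟩
    by_cases hc : ‖x s‖ = ‖y s‖
    · rw [hc]; simp
    · exact (H _ _ (by positivity) (by positivity) (hne s hc)).le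

/-- With the same `a` and `b`, both `(a + b)^r` and `a^r + b^r` have integral `2`, and they differ
strictly wherever both `a` and `b` are positive. -/
theorem ae_eq_zero_of_norm_add [Fact (1 ≤ p)] [Fact (1 ≤ q)] (hp : p ≠ ∞) (hq : q ≠ ∞)
    (hpq : p ≠ q) {x y : Lp (Lp ℝ q ν) p μ} (h : x ⊓ y = 0) (hx : ‖x‖ = 1) (hy : ‖y‖ = 1)
    (hxy : ‖x + y‖ = 2 ^ (1 / p.toReal)) : ∀ᵐ s ∂μ, x s = 0 ∨ y s = 0 := by
  have hp0 : p ≠ 0 := (zero_lt_one.trans_le (Fact.out : 1 ≤ p)).ne'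
  have hq0 : q ≠ 0 := (zero_lt_one.trans_le (Fact.out : 1 ≤ q)).ne'
  have hP : 0 < p.toReal := ENNReal.toReal_pos hp0 hp
  have hQ : 0 < q.toReal := ENNReal.toReal_pos hq0 hq
  set r := p.toReal / q.toReal with hr
  have hr0 : 0 < r := div_pos hP hQ
  have e : ∀ a : ℝ, 0 ≤ a → (a ^ q.toReal) ^ r = a ^ p.toReal := fun a ha => by
    rw [← Real.rpow_mul ha, hr, mul_div_cancel₀ _ hQ.ne']
  have hint : ∫ s, ‖x s‖ ^ p.toReal + ‖y s‖ ^ p.toReal ∂μ = ∫ s, ‖(x + y) s‖ ^ p.toReal ∂μ := by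
    rw [integral_add (integrable_norm_rpow_Lp hp x) (integrable_norm_rpow_Lp hp y),
      integral_norm_rpow_Lp hp, integral_norm_rpow_Lp hp, integral_norm_rpow_Lp hp, hx, hy, hxy,
      ← Real.rpow_mul (by norm_num), Real.one_rpow, one_div_mul_cancel hP.ne', Real.rpow_one]
    norm_num
  refine ae_of_integral_eq_of_dichotomy
    ((integrable_norm_rpow_Lp hp x).add (integrable_norm_rpow_Lp hp y))
    (integrable_norm_rpow_Lp hp (x + y)) hint ?_
  refine (add_rpow_dichotomy (toReal_div_toReal_ne_one hp hq hpq)).imp (fun H => ?_) (fun H => ?_)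
  all_goals
    filter_upwards [ae_norm_add_rpow hq h] with s hs
    simp only [Pi.add_apply]
    rw [hs, ← e _ (norm_nonneg (x s)), ← e _ (norm_nonneg (y s)), ← hr]
    by_cases h0 : x s = 0
    · simp [h0, hQ.ne', hr0.ne']
    by_cases h1 : y s = 0
    · simp [h1, hQ.ne', hr0.ne']
    have := H _ _ (Real.rpow_pos_of_pos (norm_pos_iff.2 h0) q.toReal)
      (Real.rpow_pos_of_pos (norm_pos_iff.2 h1) q.toReal)
    exact ⟨this.le, fun _ => this⟩

end Rigidity

theorem ae_isDegenerateFrame {p q : ℝ≥0∞} [Fact (1 ≤ p)] [Fact (1 ≤ q)] (hp : p ≠ ∞) (hq : q ≠ ∞)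
    (hpq : p ≠ q) {ι K : Type*} [Finite ι] [Nonempty ι] {κ : ι → K} {x : ι → LpLq p q}
    (hx0 : ∀ i, 0 ≤ x i) (hx1 : ∀ i, ‖x i‖ = 1) (hd : ∀ i j, i ≠ j → x i ⊓ x j = 0)
    (hsame : ∀ i j, i ≠ j → κ i = κ j → ‖x i + x j‖ = 2 ^ (1 / q.toReal))
    (hdiff : ∀ i j, κ i ≠ κ j → ‖x i + x j‖ = 2 ^ (1 / p.toReal)) :
    ∀ᵐ s ∂lebesgueUnit, ∃ k c, IsDegenerateFrame κ k c fun i => x i s := by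
  have h1 : ∀ᵐ s ∂lebesgueUnit, ∀ i j, κ i = κ j → ‖x i s‖ = ‖x j s‖ := by
    refine ae_all_iff.2 fun i => ae_all_iff.2 fun j => ?_
    by_cases hij : i = j
    · simp [hij]
    by_cases hk : κ i = κ j
    · filter_upwards [ae_norm_eq_of_norm_add hp hq hpq (hd i j hij) (hx1 i) (hx1 j)
        (hsame i j hij hk)] with s hs _ using hs
    · simp [hk]
  have h2 : ∀ᵐ s ∂lebesgueUnit, ∀ i j, κ i ≠ κ j → x i s = 0 ∨ x j s = 0 := by
    refine ae_all_iff.2 fun i => ae_all_iff.2 fun j => ?_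
    by_cases hk : κ i = κ j
    · simp [hk]
    · have hij : i ≠ j := fun h => hk (congrArg κ h)
      filter_upwards [ae_eq_zero_of_norm_add hp hq hpq (hd i j hij) (hx1 i) (hx1 j)
        (hdiff i j hk)] with s hs _ using hs
  have h3 : ∀ᵐ s ∂lebesgueUnit, ∀ i j, i ≠ j → x i s ⊓ x j s = 0 := by
    refine ae_all_iff.2 fun i => ae_all_iff.2 fun j => ?_
    by_cases hij : i = j
    · simp [hij]
    · filter_upwards [ae_inf_eq_zero (hd i j hij)] with s hs _ using hs
  have h4 : ∀ᵐ s ∂lebesgueUnit, ∀ i, 0 ≤ x i s :=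
    ae_all_iff.2 fun i => (Lp.coeFn_nonneg (x i)).2 (hx0 i)
  filter_upwards [h1, h2, h3, h4] with s h1 h2 h3 h4
  have hn : ∀ i, ∀ᵐ t ∂lebesgueUnit, 0 ≤ x i s t := fun i => (Lp.coeFn_nonneg (x i s)).2 (h4 i)
  have hdj : ∀ i j, i ≠ j → ∀ᵐ t ∂lebesgueUnit, x i s t = 0 ∨ x j s t = 0 := fun i j hij => by
    filter_upwards [ae_disjoint_of_inf_eq_zero (h3 i j hij)] with t ht using ht.2.2
  -- A nonzero value determines the live class and its norm; if all values vanish, any class serves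
  -- with `c = 0`.
  by_cases hz : ∃ i, x i s ≠ 0
  · obtain ⟨i, hi⟩ := hz
    exact ⟨κ i, ‖x i s‖, fun j hj => (h2 j i hj).resolve_right hi, fun j hj => h1 j i hj, hn, hdj⟩
  · push Not at hz
    exact ⟨κ (Classical.arbitrary ι), 0, fun j _ => hz j, fun j _ => by simp [hz j], hn, hdj⟩

/-! ### Atomic bases of finite-dimensional Banach lattices. -/

section Atoms

variable {E : Type*} [NormedAddCommGroup E] [Lattice E]

theorem smul_inf_smul_eq_zero [NormedSpace ℝ E] [IsOrderedModule ℝ E] {a b : E}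
    (h : a ⊓ b = 0) {c d : ℝ} (hc : 0 < c) (hd : 0 < d) :
    c • a ⊓ d • b = 0 := by
  have ha : 0 ≤ a := h.ge.trans inf_le_left
  have hb : 0 ≤ b := h.ge.trans inf_le_right
  have hm : 0 < max c d := lt_max_of_lt_left hc
  refine le_antisymm ?_ (le_inf (smul_nonneg hc.le ha) (smul_nonneg hd.le hb))
  have h1 : (max c d)⁻¹ • (c • a ⊓ d • b) ≤ a ⊓ b := by
    refine le_inf ?_ ?_
    · rw [inv_smul_le_iff_of_pos hm]
      exact inf_le_left.trans (smul_le_smul_of_nonneg_right (le_max_left _ _) ha)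
    · rw [inv_smul_le_iff_of_pos hm]
      exact inf_le_right.trans (smul_le_smul_of_nonneg_right (le_max_right _ _) hb)
  rwa [inv_smul_le_iff_of_pos hm, h, smul_zero] at h1

/-- A finite sequence of positive, nonzero, pairwise disjoint elements. -/
def IsDisjointSeq {n : ℕ} (e : Fin n → E) : Prop :=
  (∀ i, 0 < e i) ∧ ∀ i j, i ≠ j → e i ⊓ e j = 0

theorem IsDisjointSeq.cons {n : ℕ} {e : Fin n → E} (he : IsDisjointSeq e) {z : E} (hz : 0 < z)
    (hze : ∀ i, z ⊓ e i = 0) : IsDisjointSeq (Fin.cons z e : Fin (n + 1) → E) := by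
  refine ⟨fun i => ?_, fun i j hij => ?_⟩
  · refine Fin.cases ?_ (fun i => ?_) i
    · simpa using hz
    · simpa using he.1 i
  · revert hij
    refine Fin.cases ?_ (fun i => ?_) i <;> refine Fin.cases ?_ (fun j => ?_) j
    · simp
    · intro _; simpa using hze j
    · intro _; rw [inf_comm]; simpa using hze i
    · intro hij
      simpa using he.2 i j (fun h => hij (congrArg _ h))

theorem IsDisjointSeq.update {n : ℕ} {e : Fin n → E} (he : IsDisjointSeq e) (i : Fin n) {b : E}
    (hb : 0 < b) (hbe : b ≤ e i) : IsDisjointSeq (Function.update e i b) := by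
  have hlt : ∀ j, j ≠ i → b ⊓ e j = 0 := fun j hj =>
    le_antisymm ((inf_le_inf_right _ hbe).trans (he.2 i j hj.symm).le) (le_inf hb.le (he.1 j).le)
  refine ⟨fun j => ?_, fun j k hjk => ?_⟩
  · by_cases hj : j = i
    · rw [hj, Function.update_self]; exact hb
    · rw [Function.update_of_ne hj]; exact he.1 j
  · by_cases hj : j = i
    · have hk : k ≠ i := fun h => hjk (hj.trans h.symm)
      rw [hj, Function.update_self, Function.update_of_ne hk]
      exact hlt k hk
    · rw [Function.update_of_ne hj]
      by_cases hk : k = i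
      · rw [hk, Function.update_self, inf_comm]
        exact hlt j hj
      · rw [Function.update_of_ne hk]
        exact he.2 j k hjk

variable [IsOrderedAddMonoid E] [HasSolidNorm E]

theorem norm_le_norm_sub_of_inf_eq_zero {a b : E} (h : a ⊓ b = 0) : ‖a‖ ≤ ‖a - b‖ := by
  refine norm_le_norm_of_abs_le_abs ?_
  have ha : 0 ≤ a := h.ge.trans inf_le_left
  rw [abs_of_nonneg ha, abs_sub_comm, ← sup_sub_inf_eq_abs_sub, h, sub_zero]
  exact le_sup_left

variable [NormedSpace ℝ E] [IsOrderedModule ℝ E]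

/-- Normalized disjoint vectors are unit vectors at mutual distance at least `1`, so a packing bound
applies. Any bound would do: it only serves to produce a longest disjoint sequence. -/
theorem IsDisjointSeq.le_pow_finrank [FiniteDimensional ℝ E] {n : ℕ} {e : Fin n → E}
    (he : IsDisjointSeq e) : n ≤ 5 ^ Module.finrank ℝ E := by
  classical
  have hn : ∀ i, 0 < ‖e i‖ := fun i => norm_pos_iff.2 (he.1 i).ne'
  let f : Fin n → E := fun i => ‖e i‖⁻¹ • e i
  have hf1 : ∀ i, ‖f i‖ = 1 := fun i => by
    simp only [f, norm_smul, norm_inv, norm_norm]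
    exact inv_mul_cancel₀ (hn i).ne'
  have hf : ∀ i j, i ≠ j → 1 ≤ ‖f i - f j‖ := fun i j hij => by
    rw [← hf1 i]
    exact norm_le_norm_sub_of_inf_eq_zero
      (smul_inf_smul_eq_zero (he.2 i j hij) (inv_pos.2 (hn i)) (inv_pos.2 (hn j)))
  have hinj : Function.Injective f := fun i j hij => by
    by_contra hc
    have := hf i j hc
    rw [hij, sub_self, norm_zero] at this
    linarith
  have := Besicovitch.card_le_of_separated (Finset.univ.image f) (fun c hc => by
    obtain ⟨i, -, rfl⟩ := Finset.mem_image.1 hc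
    rw [hf1]; norm_num) (fun c hc d hd hcd => by
    obtain ⟨i, -, rfl⟩ := Finset.mem_image.1 hc
    obtain ⟨j, -, rfl⟩ := Finset.mem_image.1 hd
    exact hf i j fun h => hcd (congrArg f h))
  rwa [Finset.card_image_of_injective _ hinj, Finset.card_univ, Fintype.card_fin] at this

theorem exists_maximal_isDisjointSeq (E : Type*) [NormedAddCommGroup E] [NormedSpace ℝ E]
    [Lattice E] [IsOrderedAddMonoid E] [IsOrderedModule ℝ E] [HasSolidNorm E]
    [FiniteDimensional ℝ E] :
    ∃ (n : ℕ) (e : Fin n → E), IsDisjointSeq e ∧ ∀ e' : Fin (n + 1) → E, ¬IsDisjointSeq e' := by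
  let S : Set ℕ := {n | ∃ e : Fin n → E, IsDisjointSeq e}
  have hne : S.Nonempty := ⟨0, fun i => i.elim0, fun i => i.elim0, fun i => i.elim0⟩
  have hbd : BddAbove S := ⟨_, fun n ⟨_, he⟩ => he.le_pow_finrank⟩
  obtain ⟨e, he⟩ := Nat.sSup_mem hne hbd
  exact ⟨_, e, he, fun e' he' => absurd (le_csSup hbd ⟨e', he'⟩) (by simp)⟩

/-- Let `t₀` be the largest `t` in `[0, 1]` with `t • e i ≤ y`. If `y ≰ t • e i` for some `t` in
`(t₀, 1]`, the positive and negative parts of `y - t • e i` are both nonzero, disjoint and below `e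
i`. Replacing `e i` by these two would give a longer disjoint sequence. Letting `t → t₀` gives `y ≤
t₀ • e i`. -/
theorem eq_smul_of_le_of_maximal {n : ℕ} {e : Fin n → E} (he : IsDisjointSeq e)
    (hmax : ∀ e' : Fin (n + 1) → E, ¬IsDisjointSeq e') (i : Fin n) {y : E} (hy0 : 0 ≤ y)
    (hy : y ≤ e i) : ∃ t : ℝ, y = t • e i := by
  have hcl : IsClosed {t : ℝ | t • e i ≤ y} :=
    isClosed_le (by fun_prop) continuous_const
  obtain ⟨t₀, ht₀, hmaxt⟩ := (isCompact_Icc.inter_right hcl).exists_isGreatest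
    (⟨0, ⟨le_rfl, zero_le_one⟩, by simpa using hy0⟩ :
      (Icc (0 : ℝ) 1 ∩ {t : ℝ | t • e i ≤ y}).Nonempty)
  refine ⟨t₀, le_antisymm ?_ ht₀.2⟩
  rcases ht₀.1.2.eq_or_lt with h1 | h1
  · rw [h1, one_smul]; exact hy
  have hup : ∀ t ∈ Ioc t₀ 1, y ≤ t • e i := by
    intro t ht
    have ht0 : 0 < t := ht₀.1.1.trans_lt ht.1
    by_contra hc
    have hneg : (y - t • e i)⁻ ≠ 0 := by
      intro h
      rw [negPart_eq_zero, sub_nonneg] at h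
      exact absurd (hmaxt ⟨⟨ht0.le, ht.2⟩, h⟩) (not_le.2 ht.1)
    have hpos : (y - t • e i)⁺ ≠ 0 := by
      intro h
      rw [posPart_eq_zero, sub_nonpos] at h
      exact hc h
    have hte : 0 ≤ t • e i := smul_nonneg ht0.le (he.1 i).le
    have hbe : (y - t • e i)⁻ ≤ e i := by
      refine sup_le ?_ (he.1 i).le
      rw [neg_sub]
      refine (sub_le_self _ hy0).trans ?_
      conv_rhs => rw [← one_smul ℝ (e i)]
      exact smul_le_smul_of_nonneg_right ht.2 (he.1 i).le
    have hae : (y - t • e i)⁺ ≤ e i := sup_le ((sub_le_self _ hte).trans hy) (he.1 i).le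
    have hb := lt_of_le_of_ne (negPart_nonneg (y - t • e i)) hneg.symm
    have ha := lt_of_le_of_ne (posPart_nonneg (y - t • e i)) hpos.symm
    refine hmax _ ((he.update i hb hbe).cons ha fun j => ?_)
    by_cases hj : j = i
    · rw [hj, Function.update_self]
      exact posPart_inf_negPart_eq_zero _
    · rw [Function.update_of_ne hj]
      exact le_antisymm ((inf_le_inf_right _ hae).trans (he.2 i j (Ne.symm hj)).le)
        (le_inf ha.le (he.1 j).le)
  have hcl' : IsClosed {t : ℝ | y ≤ t • e i} := isClosed_le continuous_const (by fun_prop)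
  have : t₀ ∈ closure (Ioc t₀ 1) := by
    rw [closure_Ioc h1.ne]
    exact ⟨le_rfl, h1.le⟩
  exact hcl'.closure_subset_iff.2 hup this

/-- For `x ≥ 0`, maximize `∑ a i` subject to `a ≥ 0` and `∑ a i • e i ≤ x`. The remainder `z` meets
each `e i` in a multiple of `e i`, which must vanish or `a i` could be increased. So `z` is disjoint
from the whole sequence and is zero by maximality. -/
theorem span_eq_top_of_maximal {n : ℕ} {e : Fin n → E} (he : IsDisjointSeq e)
    (hmax : ∀ e' : Fin (n + 1) → E, ¬IsDisjointSeq e') : Submodule.span ℝ (range e) = ⊤ := by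
  have hn : ∀ i, 0 < ‖e i‖ := fun i => norm_pos_iff.2 (he.1 i).ne'
  have key : ∀ x : E, 0 ≤ x → x ∈ Submodule.span ℝ (range e) := by
    intro x hx
    let C : Set (Fin n → ℝ) := {a | (∀ i, 0 ≤ a i) ∧ ∑ i, a i • e i ≤ x}
    have hCcl : IsClosed C := by
      have h1 : C = (⋂ i, {a : Fin n → ℝ | 0 ≤ a i}) ∩ {a | ∑ i, a i • e i ≤ x} := by
        ext a; simp [C]
      rw [h1]
      exact (isClosed_iInter fun i => isClosed_le continuous_const (continuous_apply i)).inter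
        (isClosed_le (by fun_prop) continuous_const)
    have hsub : C ⊆ Icc 0 fun i => ‖x‖ / ‖e i‖ := by
      rintro a ⟨ha0, ha⟩
      refine ⟨ha0, fun i => ?_⟩
      have h1 : a i • e i ≤ x := le_trans (Finset.single_le_sum
        (f := fun i => a i • e i) (fun j _ => smul_nonneg (ha0 j) (he.1 j).le)
        (Finset.mem_univ i)) ha
      have h2 : ‖a i • e i‖ ≤ ‖x‖ := norm_le_norm_of_abs_le_abs (by
        rwa [abs_of_nonneg (smul_nonneg (ha0 i) (he.1 i).le), abs_of_nonneg hx])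
      rw [norm_smul, Real.norm_of_nonneg (ha0 i)] at h2
      exact (le_div_iff₀ (hn i)).2 h2
    have hC : IsCompact C := isCompact_Icc.of_isClosed_subset hCcl hsub
    obtain ⟨a, ⟨ha0, ha⟩, hamax⟩ := hC.exists_isMaxOn (f := fun a => ∑ i, a i)
      ⟨0, fun _ => le_rfl, by simpa using hx⟩ (by fun_prop)
    set z := x - ∑ i, a i • e i with hz
    have hz0 : 0 ≤ z := sub_nonneg.2 ha
    have hdisj : ∀ i, z ⊓ e i = 0 := by
      intro i
      have h0 : 0 ≤ z ⊓ e i := le_inf hz0 (he.1 i).le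
      obtain ⟨t, ht⟩ := eq_smul_of_le_of_maximal he hmax i h0 inf_le_right
      have ht0 : t ≤ 0 := by
        by_contra hc
        rw [not_le] at hc
        have hle : ∑ j, (a + Pi.single i t : Fin n → ℝ) j • e j ≤ x := by
          have : ∑ j, (a + Pi.single i t : Fin n → ℝ) j • e j = ∑ j, a j • e j + t • e i := by
            simp only [Pi.add_apply, add_smul, Finset.sum_add_distrib]
            congr 1
            rw [Finset.sum_eq_single i] <;> simp +contextual
          rw [this, ← le_sub_iff_add_le', ← hz, ← ht]
          exact inf_le_left
        have hmem : a + Pi.single i t ∈ C := by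
          refine ⟨fun j => add_nonneg (ha0 j) ?_, hle⟩
          by_cases hj : j = i
          · rw [hj, Pi.single_eq_same]; exact hc.le
          · rw [Pi.single_eq_of_ne hj]
        have := hamax hmem
        simp only [mem_ofPred_eq, Pi.add_apply, Finset.sum_add_distrib, Finset.sum_pi_single',
          Finset.mem_univ, if_true] at this
        linarith
      refine le_antisymm ?_ h0
      rw [ht]
      exact smul_nonpos_of_nonpos_of_nonneg ht0 (he.1 i).le
    have hz' : z = 0 := by
      by_contra hc
      exact hmax _ (he.cons (lt_of_le_of_ne hz0 (Ne.symm hc)) hdisj)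
    rw [sub_eq_zero.1 hz']
    exact Submodule.sum_mem _ fun i _ =>
      Submodule.smul_mem _ _ (Submodule.subset_span (mem_range_self i))
  refine eq_top_iff.2 fun x _ => ?_
  rw [← posPart_sub_negPart x]
  exact Submodule.sub_mem _ (key _ (posPart_nonneg x)) (key _ (negPart_nonneg x))

theorem exists_atomic_basis (E : Type*) [NormedAddCommGroup E] [NormedSpace ℝ E]
    [Lattice E] [IsOrderedAddMonoid E] [IsOrderedModule ℝ E] [HasSolidNorm E]
    [FiniteDimensional ℝ E] :
    ∃ (n : ℕ) (e : Fin n → E), (∀ i, 0 ≤ e i) ∧ (∀ i, ‖e i‖ = 1) ∧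
      (∀ i j, i ≠ j → e i ⊓ e j = 0) ∧ (∀ i y, 0 ≤ y → y ≤ e i → ∃ t : ℝ, y = t • e i) ∧
      Submodule.span ℝ (range e) = ⊤ := by
  obtain ⟨n, e, he, hmax⟩ := exists_maximal_isDisjointSeq E
  have hn : ∀ i, 0 < ‖e i‖⁻¹ := fun i => inv_pos.2 (norm_pos_iff.2 (he.1 i).ne')
  have he' : IsDisjointSeq fun i => ‖e i‖⁻¹ • e i :=
    ⟨fun i => lt_of_le_of_ne (smul_nonneg (hn i).le (he.1 i).le)
      (smul_ne_zero (hn i).ne' (he.1 i).ne').symm,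
      fun i j hij => smul_inf_smul_eq_zero (he.2 i j hij) (hn i) (hn j)⟩
  refine ⟨n, _, fun i => (he'.1 i).le, fun i => ?_, he'.2,
    fun i y h0 h1 => eq_smul_of_le_of_maximal he' hmax i h0 h1, span_eq_top_of_maximal he' hmax⟩
  rw [norm_smul, norm_inv, norm_norm, inv_mul_cancel₀ (norm_ne_zero_iff.2 (he.1 i).ne')]

end Atoms

/-! ### Two possible norms for the sum of two atoms. -/

section Dichotomy

variable {α β : Type*} [MeasurableSpace α] [MeasurableSpace β] {μ : Measure α} {ν : Measure β}
  {p q : ℝ≥0∞}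

/-- The hypothesis says that no measurable set splits the support of `x`, so the measurable ratio
`‖y s‖ / ‖x s‖` is a.e. constant there. -/
theorem exists_norm_eq_const_mul [Fact (1 ≤ p)] {X Y : Type*} [NormedAddCommGroup X]
    [NormedAddCommGroup Y] {x : Lp X p μ} (y : Lp Y p μ)
    (h : ∀ A, MeasurableSet A → (∀ᵐ s ∂μ, s ∈ A → x s = 0) ∨ ∀ᵐ s ∂μ, s ∉ A → x s = 0) :
    ∃ c : ℝ, ∀ᵐ s ∂μ, x s ≠ 0 → ‖y s‖ = c * ‖x s‖ := by
  have hxm : Measurable fun s => ‖x s‖ := (Lp.stronglyMeasurable x).norm.measurable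
  have hym : Measurable fun s => ‖y s‖ := (Lp.stronglyMeasurable y).norm.measurable
  have hS : MeasurableSet {s | x s ≠ 0} := by
    have : {s | x s ≠ 0} = (fun s => ‖x s‖) ⁻¹' {0}ᶜ := by ext s; simp
    rw [this]
    exact hxm (measurableSet_singleton 0).compl
  obtain ⟨c, hc⟩ := Filter.exists_eventuallyEq_const_of_forall_separating
    (l := ae (μ.restrict {s | x s ≠ 0})) (f := fun s => ‖y s‖ / ‖x s‖) MeasurableSet (by
      intro U hU
      rw [ae_restrict_iff' hS, ae_restrict_iff' hS]
      rcases h _ ((hym.div hxm) hU) with h | h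
      · right
        filter_upwards [h] with s hs hx hsU using hx (hs hsU)
      · left
        filter_upwards [h] with s hs hx
        by_contra hsU
        exact hx (hs hsU))
  refine ⟨c, ?_⟩
  filter_upwards [(ae_restrict_iff' hS).1 hc] with s hs hx
  have := hs hx
  simp only [Function.const_apply] at this
  rw [← this, div_mul_cancel₀ _ (norm_ne_zero_iff.2 hx)]

theorem norm_eq_rpow_of_rpow_eq {a b r : ℝ} (ha : 0 ≤ a) (hr : r ≠ 0) (h : a ^ r = b) :
    a = b ^ (1 / r) := by
  rw [← h, ← Real.rpow_mul ha, mul_one_div_cancel hr, Real.rpow_one]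

/-- The fibre norms of `x` and `y` are proportional on each of the two supports. A zero ratio means
disjoint base supports, hence `p`-additivity. Otherwise the norms are proportional everywhere, equal
because `‖x‖ = ‖y‖`, and the sum is `q`-additive in each fibre. -/
theorem norm_add_of_ae_zero_or_full [Fact (1 ≤ p)] [Fact (1 ≤ q)] (hp : p ≠ ∞) (hq : q ≠ ∞)
    {x y : Lp (Lp ℝ q ν) p μ} (hxy : x ⊓ y = 0) (hx1 : ‖x‖ = 1) (hy1 : ‖y‖ = 1)
    (hx : ∀ A, MeasurableSet A → (∀ᵐ s ∂μ, s ∈ A → x s = 0) ∨ ∀ᵐ s ∂μ, s ∉ A → x s = 0)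
    (hy : ∀ A, MeasurableSet A → (∀ᵐ s ∂μ, s ∈ A → y s = 0) ∨ ∀ᵐ s ∂μ, s ∉ A → y s = 0) :
    ‖x + y‖ = 2 ^ (1 / q.toReal) ∨ ‖x + y‖ = 2 ^ (1 / p.toReal) := by
  have hp0 : p ≠ 0 := (zero_lt_one.trans_le (Fact.out : 1 ≤ p)).ne'
  have hq0 : q ≠ 0 := (zero_lt_one.trans_le (Fact.out : 1 ≤ q)).ne'
  have hP : 0 < p.toReal := ENNReal.toReal_pos hp0 hp
  have hQ : 0 < q.toReal := ENNReal.toReal_pos hq0 hq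
  set r := p.toReal / q.toReal with hr
  have hr0 : 0 < r := div_pos hP hQ
  have e : ∀ a : ℝ, 0 ≤ a → (a ^ q.toReal) ^ r = a ^ p.toReal := fun a ha => by
    rw [← Real.rpow_mul ha, hr, mul_div_cancel₀ _ hQ.ne']
  have hdis : (∀ᵐ s ∂μ, x s = 0 ∨ y s = 0) → ‖x + y‖ = 2 ^ (1 / p.toReal) := by
    intro h
    refine norm_eq_rpow_of_rpow_eq (norm_nonneg _) hP.ne' ?_
    have h1 : ∫ s, ‖(x + y) s‖ ^ p.toReal ∂μ = ∫ s, ‖x s‖ ^ p.toReal + ‖y s‖ ^ p.toReal ∂μ := by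
      refine integral_congr_ae ?_
      filter_upwards [h, Lp.coeFn_add x y] with s hs h2
      rw [h2, Pi.add_apply]
      rcases hs with h0 | h0 <;> simp [h0, hP.ne']
    rw [← integral_norm_rpow_Lp hp, h1,
      integral_add (integrable_norm_rpow_Lp hp x) (integrable_norm_rpow_Lp hp y),
      integral_norm_rpow_Lp hp, integral_norm_rpow_Lp hp, hx1, hy1, Real.one_rpow]
    norm_num
  obtain ⟨c, hc⟩ := exists_norm_eq_const_mul y hx
  obtain ⟨d, hd⟩ := exists_norm_eq_const_mul x hy
  by_cases hc0 : c = 0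
  · refine Or.inr (hdis ?_)
    filter_upwards [hc] with s hs
    by_cases h0 : x s = 0
    · exact Or.inl h0
    · right; simpa [hc0] using hs h0
  by_cases hd0 : d = 0
  · refine Or.inr (hdis ?_)
    filter_upwards [hd] with s hs
    by_cases h0 : y s = 0
    · exact Or.inr h0
    · left; simpa [hd0] using hs h0
  have hall : ∀ᵐ s ∂μ, ‖y s‖ = c * ‖x s‖ := by
    filter_upwards [hc, hd] with s h1 h2
    by_cases h0 : x s = 0
    · by_cases h3 : y s = 0
      · simp [h0, h3]
      · have := h2 h3
        rw [h0, norm_zero, eq_comm, mul_eq_zero, norm_eq_zero] at this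
        exact absurd this (by simp [hd0, h3])
    · exact h1 h0
  have hc1 : |c| = 1 := by
    have h1 : ‖y‖ = ‖c • x‖ := by
      have : ∀ᵐ s ∂μ, ‖y s‖ = ‖(c • x) s‖ := by
        filter_upwards [hall, Lp.coeFn_smul c x] with s h1 h2
        rw [h2, Pi.smul_apply, norm_smul, Real.norm_eq_abs, ← abs_of_nonneg (norm_nonneg (x s)),
          ← abs_mul, ← h1, abs_of_nonneg (norm_nonneg _)]
      exact le_antisymm (Lp.norm_le_norm_of_ae_le (this.mono fun _ h => h.le))
        (Lp.norm_le_norm_of_ae_le (this.mono fun _ h => h.ge))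
    rw [hy1, norm_smul, hx1, mul_one] at h1
    exact h1.symm
  left
  have h2 : ‖x + y‖ ^ p.toReal = 2 ^ r := by
    rw [← integral_norm_rpow_Lp hp]
    have h1 : ∫ s, ‖(x + y) s‖ ^ p.toReal ∂μ = ∫ s, 2 ^ r * ‖x s‖ ^ p.toReal ∂μ := by
      refine integral_congr_ae ?_
      filter_upwards [hall, ae_norm_add_rpow (p := p) hq hxy] with s h1 h2
      have h3 : ‖y s‖ = ‖x s‖ := by
        rw [← abs_of_nonneg (norm_nonneg (y s)), h1, abs_mul, hc1, one_mul,
          abs_of_nonneg (norm_nonneg _)]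
      rw [h2, h3, ← two_mul, Real.mul_rpow (by norm_num) (by positivity), ← hr,
        e _ (norm_nonneg _)]
    rw [h1, integral_const_mul, integral_norm_rpow_Lp hp, hx1, Real.one_rpow, mul_one]
  rw [norm_eq_rpow_of_rpow_eq (norm_nonneg _) hP.ne' h2, ← Real.rpow_mul (by norm_num), hr]
  congr 1
  field_simp

end Dichotomy

/-! ### Atoms of a band cannot be cut by subsets of the base. -/

section Band

variable {E F : Type*} [NormedAddCommGroup E] [NormedSpace ℝ E] [Lattice E]
  [NormedAddCommGroup F] [NormedSpace ℝ F] [Lattice F]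

theorem PreservesLattice.le_iff {T : E →ₗᵢ[ℝ] F} (hT : PreservesLattice T) {a b : E} :
    T a ≤ T b ↔ a ≤ b := by
  rw [← inf_eq_left, ← hT.2, T.injective.eq_iff, inf_eq_left]

/-- The restriction of `T e` to `A` lies between `0` and `T e`, hence in the range by solidity,
hence equals `t • T e`. If `t = 1` then `T e` vanishes off `A`; otherwise it vanishes on `A`. -/
theorem ae_zero_or_full_of_atom {α β : Type*} [MeasurableSpace α] [MeasurableSpace β]
    {μ : Measure α} {ν : Measure β} {p q : ℝ≥0∞} [Fact (1 ≤ p)] [Fact (1 ≤ q)]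
    {T : E →ₗᵢ[ℝ] Lp (Lp ℝ q ν) p μ} (hT : PreservesLattice T)
    (hband : IsBand T.toLinearMap.range) {e : E} (he0 : 0 ≤ e)
    (he : ∀ y, 0 ≤ y → y ≤ e → ∃ t : ℝ, y = t • e) {A : Set α} (hA : MeasurableSet A) :
    (∀ᵐ s ∂μ, s ∈ A → T e s = 0) ∨ ∀ᵐ s ∂μ, s ∉ A → T e s = 0 := by
  have hTe : 0 ≤ T e := by rw [← map_zero T, hT.le_iff]; exact he0
  have hmem : MemLp (A.indicator (T e)) p μ := (Lp.memLp (T e)).indicator hA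
  have hz := hmem.coeFn_toLp
  set z := hmem.toLp
  have hz0 : 0 ≤ z := by
    rw [← Lp.coeFn_nonneg]
    filter_upwards [hz, (Lp.coeFn_nonneg (T e)).2 hTe] with s h1 h2
    rw [h1]
    exact indicator_apply_nonneg fun _ => h2
  have hze : z ≤ T e := by
    rw [← Lp.coeFn_le]
    filter_upwards [hz, (Lp.coeFn_nonneg (T e)).2 hTe] with s h1 h2
    rw [h1]
    exact indicator_apply_le' (fun _ => le_rfl) fun _ => h2
  obtain ⟨y, hy⟩ : z ∈ T.toLinearMap.range :=
    hband.solid ⟨e, rfl⟩ (by rwa [abs_of_nonneg hz0, LinearIsometry.coe_toLinearMap,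
      abs_of_nonneg hTe])
  have hy : T y = z := hy
  obtain ⟨t, ht⟩ := he y (by rwa [← hT.le_iff, map_zero, hy]) (by rwa [← hT.le_iff, hy])
  rw [ht, map_smul] at hy
  have hs : ∀ᵐ s ∂μ, t • T e s = A.indicator (T e) s := by
    filter_upwards [hz, Lp.coeFn_smul t (T e)] with s h1 h2
    rw [← h1, ← hy, h2, Pi.smul_apply]
  by_cases ht1 : t = 1
  · right
    filter_upwards [hs] with s h1 hsA
    rwa [indicator_of_notMem hsA, ht1, one_smul] at h1
  · left
    filter_upwards [hs] with s h1 hsA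
    rw [indicator_of_mem hsA, ← sub_eq_zero] at h1
    have h2 : (t - 1) • T e s = 0 := by rw [sub_smul, one_smul]; exact h1
    exact (smul_eq_zero.1 h2).resolve_left (sub_ne_zero.2 ht1)

end Band

/-! ### Proof of the theorem. -/

theorem theoremt (p q : ℝ≥0∞) [Fact (1 ≤ p)] [Fact (1 ≤ q)]
    (hp : p ≠ ∞) (hq : q ≠ ∞) (hpq : p ≠ q) :
    IsAUH.{0, u} (LpLq p q) (fun E _ _ _ => IsFinDimBLpLq.{u, v, w} p q E) := by
  intro E _ _ _ _ _ _ _ hE n g _ f₁ f₂ hf₁ hf₂ ε hε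
  obtain ⟨hfd, Ω, _, μ, Ω', _, ν, T, hT, hband⟩ := hE
  obtain ⟨m, e, he0, he1, hed, hatom, hspan⟩ := exists_atomic_basis E
  have hmap : ∀ f : E →ₗᵢ[ℝ] LpLq p q, PreservesLattice f → (∀ i, 0 ≤ f (e i)) ∧
      (∀ i, ‖f (e i)‖ = 1) ∧ ∀ i j, i ≠ j → f (e i) ⊓ f (e j) = 0 := fun f hf =>
    ⟨fun i => by rw [← map_zero f, hf.le_iff]; exact he0 i, fun i => by rw [f.norm_map, he1],
      fun i j hij => by rw [← hf.2, hed i j hij, map_zero]⟩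
  obtain ⟨h10, h11, h1d⟩ := hmap f₁ hf₁
  obtain ⟨h20, h21, h2d⟩ := hmap f₂ hf₂
  have hdich : ∀ i j, i ≠ j → ‖e i + e j‖ = 2 ^ (1 / q.toReal) ∨
      ‖e i + e j‖ = 2 ^ (1 / p.toReal) := fun i j hij => by
    have := norm_add_of_ae_zero_or_full hp hq (x := T (e i)) (y := T (e j))
      (by rw [← hT.2, hed i j hij, map_zero]) (by rw [T.norm_map, he1]) (by rw [T.norm_map, he1])
      (fun A hA => ae_zero_or_full_of_atom hT hband (he0 i) (hatom i) hA)
      (fun A hA => ae_zero_or_full_of_atom hT hband (he0 j) (hatom j) hA)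
    rwa [← map_add, T.norm_map] at this
  -- Defined by fibre norms under `f₁`, the relation is visibly transitive. `hsame` and `hdiff` then
  -- express it through `‖e i + e j‖` alone, so the same classes serve for `f₂`.
  let st : Setoid (Fin m) :=
    { r := fun i j => ∀ᵐ s ∂lebesgueUnit, ‖f₁ (e i) s‖ = ‖f₁ (e j) s‖
      iseqv := ⟨fun i => Filter.Eventually.of_forall fun _ => rfl,
        fun h => h.mono fun _ => Eq.symm, fun h h' => by
          filter_upwards [h, h'] with s h1 h2 using h1.trans h2⟩ }
  let κ : Fin m → Quotient st := Quotient.mk st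
  have hκ : Function.Surjective κ := Quotient.mk_surjective
  have hsame : ∀ i j, i ≠ j → κ i = κ j → ‖e i + e j‖ = 2 ^ (1 / q.toReal) := by
    intro i j hij hk
    refine (hdich i j hij).resolve_right fun hc => ?_
    have h1 : ∀ᵐ s ∂lebesgueUnit, ‖f₁ (e i) s‖ = ‖f₁ (e j) s‖ := Quotient.exact hk
    have h2 := ae_eq_zero_of_norm_add hp hq hpq (h1d i j hij) (h11 i) (h11 j)
      (by rw [← map_add, f₁.norm_map, hc])
    have h3 : f₁ (e i) = 0 := by
      refine Lp.ext ?_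
      filter_upwards [h1, h2, Lp.coeFn_zero (Lp ℝ q lebesgueUnit) p lebesgueUnit] with s h1 h2 h3
      rw [h3, Pi.zero_apply]
      rcases h2 with h | h
      · exact h
      · rw [h, norm_zero] at h1
        exact norm_eq_zero.1 h1
    have := h11 i
    rw [h3, norm_zero] at this
    exact zero_ne_one this
  have hdiff : ∀ i j, κ i ≠ κ j → ‖e i + e j‖ = 2 ^ (1 / p.toReal) := by
    intro i j hk
    have hij : i ≠ j := fun h => hk (congrArg κ h)
    refine (hdich i j hij).resolve_left fun hc => hk (Quotient.sound ?_)
    exact ae_norm_eq_of_norm_add hp hq hpq (h1d i j hij) (h11 i) (h11 j)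
      (by rw [← map_add, f₁.norm_map, hc])
  rcases isEmpty_or_nonempty (Fin m) with hm | hm
  · have hsub : ∀ x : E, x = 0 := fun x => by
      have : x ∈ Submodule.span ℝ (range e) := by rw [hspan]; trivial
      rwa [range_eq_empty, Submodule.span_empty, Submodule.mem_bot] at this
    refine ⟨LinearIsometryEquiv.refl ℝ _, ⟨fun _ _ => rfl, fun _ _ => rfl⟩, fun j => ?_⟩
    simpa [hsub (g j)] using hε
  have hg : ∀ j, ∃ a : Fin m → ℝ, ∑ i, a i • e i = g j := fun j => by
    have : g j ∈ Submodule.span ℝ (range e) := by rw [hspan]; trivial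
    exact (Submodule.mem_span_range_iff_exists_fun ℝ).1 this
  choose a ha using hg
  have hsum : 0 ≤ ∑ j, ∑ i, |a j i| := by positivity
  obtain ⟨φ, hφ, hφe⟩ := exists_automorphism_of_isDegenerateFrame hp hq hκ
    (fun i => f₁ (e i)) (fun i => f₂ (e i)) h11 h21
    (ae_isDegenerateFrame hp hq hpq h10 h11 h1d
      (fun i j hij hk => by rw [← map_add, f₁.norm_map, hsame i j hij hk])
      (fun i j hk => by rw [← map_add, f₁.norm_map, hdiff i j hk]))
    (ae_isDegenerateFrame hp hq hpq h20 h21 h2d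
      (fun i j hij hk => by rw [← map_add, f₂.norm_map, hsame i j hij hk])
      (fun i j hk => by rw [← map_add, f₂.norm_map, hdiff i j hk]))
    -- The total of the coefficients of the `g j` in the atomic basis bounds the loss in passing
    -- from atoms to generators; the summand `1` keeps the denominator positive and the final
    -- inequality strict.
    (ε := ε / (1 + ∑ j, ∑ i, |a j i|)) (by positivity)
  refine ⟨φ, hφ, fun j => ?_⟩
  have h1 : φ (f₁ (g j)) - f₂ (g j) = ∑ i, a j i • (φ (f₁ (e i)) - f₂ (e i)) := by
    rw [← ha j]
    simp only [map_sum, map_smul, smul_sub, Finset.sum_sub_distrib]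
  have h2 : ∑ i, |a j i| ≤ ∑ j, ∑ i, |a j i| :=
    Finset.single_le_sum (f := fun j => ∑ i, |a j i|) (fun _ _ => by positivity)
      (Finset.mem_univ j)
  calc ‖φ (f₁ (g j)) - f₂ (g j)‖ ≤ ∑ i, ‖a j i • (φ (f₁ (e i)) - f₂ (e i))‖ := by
        rw [h1]; exact norm_sum_le _ _
    _ ≤ ∑ i, |a j i| * (ε / (1 + ∑ j, ∑ i, |a j i|)) := by
        refine Finset.sum_le_sum fun i _ => ?_
        rw [norm_smul, Real.norm_eq_abs]
        exact mul_le_mul_of_nonneg_left (hφe i).le (abs_nonneg _)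
    _ = (∑ i, |a j i|) * (ε / (1 + ∑ j, ∑ i, |a j i|)) := by rw [Finset.sum_mul]
    _ < ε := by
        rw [mul_div_assoc', div_lt_iff₀ (by positivity)]
        nlinarith
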